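/- **Setting.** For a real skew-symmetric matrix $\Theta$ of size $d$, let $A_\Theta$ be the noncommutative torus, i.e. the $C^*$-algebra generated by unitaries $U_1,\dots,U_d$ with $U_kU_j=e^{2\pi i\Theta_{jk}}U_jU_k$ (realized as the twisted group $C^*$-algebra of $\mathbb Z^d$ in its faithful left regular representation on $\ell^2(\mathbb Z^d)$), with canonical trace $\tau_\Theta$. On $M_r(A_\Theta)$ use the normalized trace $\tfrac1r\mathrm{Tr}\otimes\tau_\Theta$; its smooth subalgebra $M_r(A_\Theta)^\infty$ consists of the matrices whose entries have rapidly decreasing Fourier coefficients, with its usual Fréchet topology. $\Theta$ is nondegenerate if $e^{2\pi i\langle x,\Theta y\rangle}=1$ for all $y\in\mathbb Z^d$ implies $x=0$. A toric map $\varphi_{M,z}\colon A_\Theta\to A_{\Psi}$ is a unital $*$-homomorphism with $U_j\mapsto z_jV^{Me_j}$, where $M$ is an integer matrix, $|z_j|=1$, and $V^x=V_1^{x_1}\cdots V_{d'}^{x_{d'}}$ in the generators of $A_\Psi$. A *protoral system* is a sequence $B_n=M_{r_n}(A_{\Theta_n})$, with $r_n\ge1$ and $\Theta_n$ nondegenerate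 skew-symmetric of size $d_n\ge2$, with nonzero $*$-homomorphisms $\phi_n\colon B_n\to B_{n+1}$. Write $\phi_{n,m}\colon B_n\to B_m$ for the composites, $A_{pro}=\varinjlim(B_n,\phi_n)$ for the $C^*$-inductive limit, $\iota_n\colon B_n\to A_{pro}$ for the canonical maps, $e_n=\iota_n(1_{B_n})$, and $\tau_n$ for the normalized trace on $B_n$. A *Morita-compatible Dirac structure* on it consists of, for every $n$: 1. a factorization $\phi_n=\iota_{p_n}\circ\alpha_n\circ\psi_n$, where $\psi_n=\mathrm{Id}_{M_{r_n}}\otimes\varphi_{M_n,z_n}\colon B_n\to C_n=M_{r_n}(A_{\Psi_n})$ is an amplified unital toric map (possibly the identity), $p_n\in B_{n+1}^\infty$ is a full projection, $\alpha_n\colon C_n\to p_nB_{n+1}p_n$ is a $*$-isomorphism that restricts to a Fréchet $*$-isomorphism $C_n^\infty\cong p_nB_{n+1}^\infty p_n$, and $\iota_{p_n}$ is the inclusion of the corner (a pure corner map, or a corner map preceded by a dimension-changing or same-dimensional toric map); 2. finite-dimensional Hilbert spaces $S_n\neq0$, $S_n^C$, $S_{n+1}^{(p_n)}$, with $H_n=L^2(B_n,\tau_n)\otimes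 S_n$, $H_n^C=L^2(C_n,\omega_n)\otimes S_n^C$, $H_{n+1}^{(p_n)}=L^2(p_nB_{n+1}p_n,\tau_{p_n})\otimes S_{n+1}^{(p_n)}$, where $\omega_n$ is the normalized trace on $C_n$ and $\tau_{p_n}=\tau_{n+1}/\tau_{n+1}(p_n)$, and with the representations by left multiplication (on $H_n$ it is denoted $\pi_n$); 3. selfadjoint operators $D_n$, $D_n^C$, $D_{n+1}^{(p_n)}$ on these spaces; 4. isometries $I_{\psi_n}\colon H_n\to H_n^C$, $I_{\alpha_n}\colon H_n^C\to H_{n+1}^{(p_n)}$, $I_{\iota_{p_n}}\colon H_{n+1}^{(p_n)}\to H_{n+1}$ that map domain into domain and intertwine the selfadjoint operators there, that intertwine the left-multiplication representations along $\psi_n,\alpha_n,\iota_{p_n}$, and whose composite $I_n\colon H_n\to H_{n+1}$ satisfies $I_n(\Lambda_n(a)\otimes\xi)=t_n^{-1/2}\Lambda_{n+1}(\phi_n(a))\otimes J_n\xi$ for all $a\in B_n$, $\xi\in S_n$, where $\Lambda_n\colon B_n\to L^2(B_n,\tau_n)$ is the canonical map, $t_n=\tau_{n+1}(\phi_n(1))$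 and $J_n\colon S_n\to S_{n+1}$ is an isometry. Put $H_{pro}=\varinjlim(H_n,I_n)$ with canonical isometries $I_{n,\infty}$ and composites $I_{m,k}\colon H_m\to H_k$, let $D_0$ be the operator with domain $\bigcup_nI_{n,\infty}(\mathrm{dom}\,D_n)$ and $D_0I_{n,\infty}\xi=I_{n,\infty}D_n\xi$, and let $D_{pro}=\overline{D_0}$. For a selfadjoint $D$ and a bounded operator $a$, "$[D,a]$ extends to a bounded operator" means that $a\,\mathrm{dom}(D)\subseteq\mathrm{dom}(D)$ and $Da-aD$ on $\mathrm{dom}(D)$ extends to a bounded operator $\overline{[D,a]}$. A locally compact spectral triple $(\mathcal A,H,D)$ on a $C^*$-algebra $A$ consists of a faithful nondegenerate representation $\pi$ of $A$ on $H$, a selfadjoint operator $D$ on $H$, and a dense $*$-subalgebra $\mathcal A\subseteq A$ such that for every $a\in\mathcal A$, $[D,\pi(a)]$ extends to a bounded operator and $\pi(a)(1+D^2)^{-1/2}$ is compact. **Theorem.** Let a protoral system be equipped with a Morita-compatible Dirac structure. Then $D_{pro}$ is selfadjoint, and there is a (unique) representation $\pi$ of $A_{pro}$ on $H_{pro}$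 with $\pi(\iota_n(b))I_{m,\infty}\eta=I_{k,\infty}\pi_k(\phi_{n,k}(b))I_{m,k}\eta$ for all $n,m\le k$, $b\in B_n$, $\eta\in H_m$; it is faithful and nondegenerate. Moreover: (i) Let $a\in B_n^\infty$ and $a_m=\phi_{n,m}(a)$ for $m\ge n$. Then $[D_{pro},\pi(\iota_n(a))]$ extends to a bounded operator on $H_{pro}$ if and only if every $[D_m,\pi_m(a_m)]$, $m\ge n$, extends to a bounded operator and $\sup_{m\ge n}\|\overline{[D_m,\pi_m(a_m)]}\|<\infty$. In that case $\overline{[D_{pro},\pi(\iota_n(a))]}\,I_{m,\infty}=I_{m,\infty}\,\overline{[D_m,\pi_m(a_m)]}$ for all $m\ge n$. (ii) Let $\mathcal A\subseteq A_{pro}$ be a dense $*$-subalgebra that contains every $e_n$ and such that every $a\in\mathcal A$ satisfies $a=e_nae_n$ for some $n$. Then $\pi(a)(1+D_{pro}^2)^{-1/2}$ is compact for every $a\in\mathcal A$ if and only if $\pi(e_n)(1+D_{pro}^2)^{-1/2}$ is compact for every $n$. (iii) Let $\mathcal A$ be as in (ii). If for every $a\in\mathcal A$ either $[D_{pro},\pi(a)]$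 extends to a bounded operator or $a=\iota_n(b)$ for some $n$ and some $b\in B_n^\infty$ that satisfies the stagewise condition of (i), and if $\pi(e_n)(1+D_{pro}^2)^{-1/2}$ is compact for every $n$, then $(\mathcal A,H_{pro},D_{pro})$, with the representation $\pi$, is a locally compact spectral triple on $A_{pro}$. -/

import Mathlib

noncomputable section

namespace Protorus

open scoped ComplexOrder TensorProduct InnerProductSpace
open Filter Topology

/-! ### Noncommutative tori -/

/-- The Hilbert space `ℓ²(ℤᵐ)`. -/
abbrev L2Z (m : ℕ) : Type := lp (fun _ : Fin m → ℤ => ℂ) 2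

/-- The `2`-cocycle `ω_Θ(x, y) = exp (2πi ∑_{j<k} Θ_{jk} x_k y_j)` on `ℤᵐ`. -/
def cocycle {m : ℕ} (Θ : Matrix (Fin m) (Fin m) ℝ) (x y : Fin m → ℤ) : ℂ :=
  Complex.exp ((2 * Real.pi * ∑ j, ∑ k, if j < k then Θ j k * x k * y j else 0 : ℝ) * Complex.I)

theorem norm_cocycle {m : ℕ} (Θ : Matrix (Fin m) (Fin m) ℝ) (x y : Fin m → ℤ) :
    ‖cocycle Θ x y‖ = 1 :=
  Complex.norm_exp_ofReal_mul_I _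

theorem hasSum_translation {m : ℕ} (Θ : Matrix (Fin m) (Fin m) ℝ) (x : Fin m → ℤ) (f : L2Z m) :
    HasSum (fun y => ‖cocycle Θ x (y - x) * f (y - x)‖ ^ (2 : ENNReal).toReal)
      (‖f‖ ^ (2 : ENNReal).toReal) := by
  have h := lp.hasSum_norm (by norm_num : 0 < (2 : ENNReal).toReal) f
  have h2 := (Equiv.hasSum_iff (Equiv.subRight x)).2 h
  refine h2.congr_fun ?_
  intro y
  simp [norm_cocycle]

/-- The `ω_Θ`-twisted left translation `λ_x` on `ℓ²(ℤᵐ)`, with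
`λ_x δ_y = ω_Θ(x, y) δ_{x+y}` and `λ_x λ_y = ω_Θ(x, y) λ_{x+y}`. -/
def translation {m : ℕ} (Θ : Matrix (Fin m) (Fin m) ℝ) (x : Fin m → ℤ) : L2Z m →ₗᵢ[ℂ] L2Z m where
  toFun f := ⟨fun y => cocycle Θ x (y - x) * f (y - x),
    memℓp_gen (hasSum_translation Θ x f).summable⟩
  map_add' f g := by
    ext y
    exact mul_add _ _ _
  map_smul' c f := by
    ext y
    simp only [lp.coeFn_smul, Pi.smul_apply, smul_eq_mul, RingHom.id_apply]
    ring
  norm_map' f := by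
    have h2 : (0 : ℝ) < (2 : ENNReal).toReal := by norm_num
    have h := lp.hasSum_norm h2 (⟨fun y => cocycle Θ x (y - x) * f (y - x),
      memℓp_gen (hasSum_translation Θ x f).summable⟩ : L2Z m)
    have h' := h.unique (hasSum_translation Θ x f)
    exact (Real.rpow_left_inj (norm_nonneg _) (norm_nonneg _) h2.ne').1 h'

theorem translation_apply {m : ℕ} (Θ : Matrix (Fin m) (Fin m) ℝ) (x : Fin m → ℤ) (f : L2Z m)
    (y : Fin m → ℤ) : translation Θ x f y = cocycle Θ x (y - x) * f (y - x) := rfl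

theorem translation_mul {m : ℕ} (Θ : Matrix (Fin m) (Fin m) ℝ) (x y : Fin m → ℤ) (f : L2Z m) :
    translation Θ x (translation Θ y f) = cocycle Θ x y • translation Θ (x + y) f := by
  ext z
  simp only [translation_apply, lp.coeFn_smul, Pi.smul_apply, smul_eq_mul, ← mul_assoc, cocycle,
    ← Complex.exp_add, ← add_mul, ← Complex.ofReal_add, ← mul_add, ← Finset.sum_add_distrib,
    sub_sub]
  congr 5
  refine Finset.sum_congr rfl fun (j : Fin m) _ => Finset.sum_congr rfl fun (k : Fin m) _ => ?_
  split_ifs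
  · simp only [Pi.sub_apply, Pi.add_apply, Int.cast_sub, Int.cast_add]
    ring
  · simp

/-- The twisted group algebra `C*(ℤᵐ, ω_Θ)`: the norm closed `*`-subalgebra of
`B(ℓ²(ℤᵐ))` generated by the twisted translations. -/
def torusSubalgebra {m : ℕ} (Θ : Matrix (Fin m) (Fin m) ℝ) :
    StarSubalgebra ℂ (L2Z m →L[ℂ] L2Z m) :=
  (StarAlgebra.adjoin ℂ
    (Set.range fun x : Fin m → ℤ => (translation Θ x).toContinuousLinearMap)).topologicalClosure

instance {m : ℕ} (Θ : Matrix (Fin m) (Fin m) ℝ) :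
    IsClosed (torusSubalgebra Θ : Set (L2Z m →L[ℂ] L2Z m)) :=
  StarSubalgebra.isClosed_topologicalClosure _

/-- The noncommutative torus `A_Θ`, realized as the twisted group `C*`-algebra of the amenable
group `ℤᵐ` in its (faithful) left regular representation. -/
def NCTorus {m : ℕ} (Θ : Matrix (Fin m) (Fin m) ℝ) : Type := torusSubalgebra Θ

namespace NCTorus

variable {m : ℕ} {Θ : Matrix (Fin m) (Fin m) ℝ}

instance : CStarAlgebra (NCTorus Θ) := inferInstanceAs (CStarAlgebra (torusSubalgebra Θ))

instance : PartialOrder (NCTorus Θ) := CStarAlgebra.spectralOrder _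

instance : StarOrderedRing (NCTorus Θ) := CStarAlgebra.spectralOrderedRing _

/-- The operator on `ℓ²(ℤᵐ)` given by an element of `A_Θ`. -/
def toCLM : NCTorus Θ →⋆ₐ[ℂ] (L2Z m →L[ℂ] L2Z m) := (torusSubalgebra Θ).subtype

variable (Θ) in
/-- The ordered monomial `U^x = U₁^{x₁} ⋯ U_m^{x_m}`, which is the twisted translation `λ_x`. -/
def monomial (x : Fin m → ℤ) : NCTorus Θ :=
  ⟨(translation Θ x).toContinuousLinearMap,
    StarSubalgebra.le_topologicalClosure _ (StarAlgebra.subset_adjoin ℂ _ ⟨x, rfl⟩)⟩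

variable (Θ) in
/-- The canonical unitary generator `U_j`. -/
def gen (j : Fin m) : NCTorus Θ := monomial Θ (Pi.single j 1)

theorem monomial_mul (x y : Fin m → ℤ) :
    monomial Θ x * monomial Θ y = cocycle Θ x y • monomial Θ (x + y) :=
  Subtype.ext (ContinuousLinearMap.ext fun f => translation_mul Θ x y f)

theorem cocycle_single (j k : Fin m) :
    cocycle Θ (Pi.single k 1) (Pi.single j 1) =
      Complex.exp ((2 * Real.pi * if j < k then Θ j k else 0 : ℝ) * Complex.I) := by
  unfold cocycle
  congr 4
  rw [Finset.sum_eq_single j, Finset.sum_eq_single k] <;> simp +contextual [Pi.single_apply]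

/-- The defining relations `U_k U_j = exp (2πi Θ_{jk}) U_j U_k`. -/
theorem gen_mul_gen (hΘ : Θ.transpose = -Θ) (j k : Fin m) :
    gen Θ k * gen Θ j = Complex.exp ((2 * Real.pi * Θ j k : ℝ) * Complex.I) •
      (gen Θ j * gen Θ k) := by
  have hs : Θ k j = -Θ j k := congrFun (congrFun hΘ j) k
  unfold gen
  rw [monomial_mul, monomial_mul, smul_smul, cocycle_single, cocycle_single, ← Complex.exp_add,
    ← add_mul, ← Complex.ofReal_add, add_comm (Pi.single k 1)]
  congr 4
  rcases lt_trichotomy j k with h | h | h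
  · simp [h, h.not_gt]
  · subst h
    simp [show Θ j j = 0 by linarith]
  · simp [h, h.not_gt, hs]

/-- The Fourier coefficient `a_x = τ_Θ((U^x)^* a) = ⟨δ_x, a δ_0⟩`, so that formally
`a = ∑_x a_x U^x`. -/
def coeff (a : NCTorus Θ) (x : Fin m → ℤ) : ℂ := toCLM a (lp.single 2 0 1) x

/-- The canonical tracial state `τ_Θ(a) = a_0 = ⟨δ_0, a δ_0⟩`. -/
def trace : NCTorus Θ →ₗ[ℂ] ℂ where
  toFun a := coeff a 0
  map_add' a b := by simp [coeff]
  map_smul' c a := by simp [coeff]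

theorem trace_star_mul_self_nonneg (a : NCTorus Θ) : 0 ≤ trace (star a * a) := by
  have h : trace (star a * a) =
      ⟪(lp.single 2 0 1 : L2Z m), toCLM (star a * a) (lp.single 2 0 1)⟫_ℂ := by
    rw [lp.inner_single_left]
    simp [trace, coeff]
  rw [h, map_mul, map_star, ContinuousLinearMap.star_eq_adjoint, mul_apply_eq_comp,
    ContinuousLinearMap.adjoint_inner_right, inner_self_eq_norm_sq_to_K (𝕜 := ℂ)]
  have h2 := Complex.zero_le_real.2 (sq_nonneg ‖toCLM a (lp.single 2 0 1)‖)
  rw [Complex.ofReal_pow] at h2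
  exact h2

end NCTorus

/-- `Θ` is nondegenerate: `exp (2πi ⟨x, Θ y⟩) = 1` for all `y ∈ ℤᵐ` forces `x = 0`. -/
def IsNondegenerate {m : ℕ} (Θ : Matrix (Fin m) (Fin m) ℝ) : Prop :=
  ∀ x : Fin m → ℤ,
    (∀ y : Fin m → ℤ,
      Complex.exp ((2 * Real.pi * ∑ j, ∑ k, (x j : ℝ) * Θ j k * (y k : ℝ) : ℝ) * Complex.I) = 1) →
    x = 0

/-- A unital toric (monomial) map `φ_{M,z} : A_Θ → A_Ψ`, determined by
`U_j ↦ z_j V^{M e_j}` for an integer matrix `M` and phases `z_j`. -/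
def IsToric {m n : ℕ} {Θ : Matrix (Fin m) (Fin m) ℝ} {Ψ : Matrix (Fin n) (Fin n) ℝ}
    (φ : NCTorus Θ →⋆ₐ[ℂ] NCTorus Ψ) : Prop :=
  ∃ (M : Matrix (Fin n) (Fin m) ℤ) (z : Fin m → Circle),
    ∀ j, φ (NCTorus.gen Θ j) = (z j : ℂ) • NCTorus.monomial Ψ (fun i => M i j)

/-! ### Matrix amplifications and their smooth subalgebras -/

/-- The matrix amplification `M_r(A_Θ)`. -/
def MatTorus (r : ℕ) {m : ℕ} (Θ : Matrix (Fin m) (Fin m) ℝ) : Type :=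
  CStarMatrix (Fin r) (Fin r) (NCTorus Θ)

namespace MatTorus

variable {r m : ℕ} {Θ : Matrix (Fin m) (Fin m) ℝ}

instance : CStarAlgebra (MatTorus r Θ) :=
  inferInstanceAs (CStarAlgebra (CStarMatrix (Fin r) (Fin r) (NCTorus Θ)))

instance : PartialOrder (MatTorus r Θ) := CStarAlgebra.spectralOrder _

instance : StarOrderedRing (MatTorus r Θ) := CStarAlgebra.spectralOrderedRing _

/-- The matrix with given entries. -/
def ofEntries (f : Fin r → Fin r → NCTorus Θ) : MatTorus r Θ := CStarMatrix.ofMatrix (Matrix.of f)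

/-- The `(i, j)` entry of a matrix over `A_Θ`. -/
def entry (b : MatTorus r Θ) (i j : Fin r) : NCTorus Θ := CStarMatrix.ofMatrix.symm b i j

/-- The smooth subalgebra `M_r(A_Θ)^∞ = M_r(A_Θ^∞)`: the Fourier coefficients of all entries are
rapidly decreasing on `ℤᵐ`. -/
def IsSmooth (b : MatTorus r Θ) : Prop :=
  ∀ k : ℕ, ∃ C : ℝ, ∀ (i j : Fin r) (x : Fin m → ℤ), (1 + ‖x‖) ^ k * ‖(b.entry i j).coeff x‖ ≤ C

/-- The seminorms `sup_{i,j,x} (1 + |x|)^k |(b_{ij})_x|` that define the Fréchet topology of the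
smooth subalgebra. -/
def smoothSeminorm (k : ℕ) (b : MatTorus r Θ) : ℝ :=
  ⨆ q : Fin r × Fin r × (Fin m → ℤ), (1 + ‖q.2.2‖) ^ k * ‖(b.entry q.1 q.2.1).coeff q.2.2‖

/-- The normalized trace `r⁻¹ Tr ⊗ τ_Θ` on `M_r(A_Θ)`. -/
def trace : MatTorus r Θ →ₚ[ℂ] ℂ :=
  PositiveLinearMap.mk₀
    { toFun := fun b => (r : ℂ)⁻¹ * ∑ i, NCTorus.trace (b.entry i i)
      map_add' := fun a b => by
        have h : ∀ i, (a + b).entry i i = a.entry i i + b.entry i i := fun _ => rfl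
        simp only [h, map_add, Finset.sum_add_distrib, mul_add]
      map_smul' := fun c a => by
        have h : ∀ i, (c • a).entry i i = c • a.entry i i := fun _ => rfl
        simp only [h, map_smul, smul_eq_mul, ← Finset.mul_sum, RingHom.id_apply]
        ring }
    (fun x hx => by
      obtain ⟨s, rfl⟩ := CStarAlgebra.nonneg_iff_eq_star_mul_self.1 hx
      refine mul_nonneg (by simp) (Finset.sum_nonneg fun i _ => ?_)
      have h : (star s * s).entry i i = ∑ k, star (s.entry k i) * s.entry k i := rfl
      rw [h, map_sum]
      exact Finset.sum_nonneg fun k _ => NCTorus.trace_star_mul_self_nonneg _)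

/-- The amplification `Id_{M_r} ⊗ φ : M_r(A_Θ) → M_r(A_Ψ)`, entrywise application of `φ`. -/
def amplify (r : ℕ) {m n : ℕ} {Θ : Matrix (Fin m) (Fin m) ℝ} {Ψ : Matrix (Fin n) (Fin n) ℝ}
    (φ : NCTorus Θ →⋆ₐ[ℂ] NCTorus Ψ) (b : MatTorus r Θ) : MatTorus r Ψ :=
  ofEntries fun i j => φ (b.entry i j)

end MatTorus

/-! ### Corners -/

/-- The corner `pBp` of a `C*`-algebra at a projection `p`, as a `*`-subalgebra. -/
def cornerSubalgebra {B : Type*} [CStarAlgebra B] (p : B) (hp : IsStarProjection p) :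
    NonUnitalStarSubalgebra ℂ B where
  carrier := {x | p * x = x ∧ x * p = x}
  add_mem' := fun ha hb => ⟨by rw [mul_add, ha.1, hb.1], by rw [add_mul, ha.2, hb.2]⟩
  zero_mem' := ⟨mul_zero _, zero_mul _⟩
  mul_mem' := fun ha hb => ⟨by rw [← mul_assoc, ha.1], by rw [mul_assoc, hb.2]⟩
  smul_mem' := fun c x hx => ⟨by rw [mul_smul_comm, hx.1], by rw [smul_mul_assoc, hx.2]⟩
  star_mem' := fun {x} hx =>
    ⟨by simpa [hp.isSelfAdjoint.star_eq] using congrArg star hx.2,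
      by simpa [hp.isSelfAdjoint.star_eq] using congrArg star hx.1⟩

instance {B : Type*} [CStarAlgebra B] (p : B) (hp : IsStarProjection p) :
    IsClosed (cornerSubalgebra p hp : Set B) :=
  (isClosed_eq (by fun_prop) (by fun_prop)).inter (isClosed_eq (by fun_prop) (by fun_prop))

/-- The corner `pBp` as a `C*`-algebra (with unit `p`). -/
def Corner {B : Type*} [CStarAlgebra B] (p : B) (hp : IsStarProjection p) : Type _ :=
  cornerSubalgebra p hp

namespace Corner

variable {B : Type*} [CStarAlgebra B] {p : B} {hp : IsStarProjection p}

instance : NonUnitalCStarAlgebra (Corner p hp) :=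
  inferInstanceAs (NonUnitalCStarAlgebra (cornerSubalgebra p hp))

instance : PartialOrder (Corner p hp) := CStarAlgebra.spectralOrder _

instance : StarOrderedRing (Corner p hp) := CStarAlgebra.spectralOrderedRing _

variable (p hp) in
/-- The corner inclusion `ι_p : pBp → B`. -/
def incl : Corner p hp →⋆ₙₐ[ℂ] B := NonUnitalStarSubalgebraClass.subtype (cornerSubalgebra p hp)

variable (p hp) in
/-- The normalized restriction `τ_p(x) = τ(x) / τ(p)` of a positive functional `τ` to the
corner. -/
def trace [PartialOrder B] [StarOrderedRing B] (τ : B →ₚ[ℂ] ℂ) : Corner p hp →ₚ[ℂ] ℂ :=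
  PositiveLinearMap.mk₀
    { toFun := fun x => τ (incl p hp x) / τ p
      map_add' := fun a b => by simp [add_div]
      map_smul' := fun c a => by simp [mul_div_assoc] }
    (fun x hx => by
      obtain ⟨s, rfl⟩ := CStarAlgebra.nonneg_iff_eq_star_mul_self.1 hx
      refine mul_nonneg ?_ (inv_nonneg.2 (τ.map_nonneg hp.nonneg))
      rw [map_mul, map_star]
      exact τ.map_nonneg (star_mul_self_nonneg _))

end Corner

/-- A projection `p ∈ B` is full: it generates `B` as a closed two-sided ideal. -/
def IsFull {B : Type*} [CStarAlgebra B] (p : B) : Prop :=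
  Dense (Submodule.span ℂ {x : B | ∃ a b, x = a * p * b} : Set B)

/-! ### The Hilbert spaces `L²(A, τ) ⊗ S` -/

theorem norm_sq_sum_tmul {G S : Type*} [NormedAddCommGroup G] [InnerProductSpace ℂ G]
    [NormedAddCommGroup S] [InnerProductSpace ℂ S] [FiniteDimensional ℂ S]
    (v : Fin (Module.finrank ℂ S) → G) :
    ‖∑ i, v i ⊗ₜ[ℂ] (stdOrthonormalBasis ℂ S i)‖ ^ 2 = ∑ i, ‖v i‖ ^ 2 := by
  have h : (⟪∑ i, v i ⊗ₜ[ℂ] (stdOrthonormalBasis ℂ S i),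
      ∑ i, v i ⊗ₜ[ℂ] (stdOrthonormalBasis ℂ S i)⟫_ℂ) = ((∑ i, ‖v i‖ ^ 2 : ℝ) : ℂ) := by
    simp [sum_inner, inner_sum, OrthonormalBasis.inner_eq_ite, inner_self_eq_norm_sq_to_K]
  have h2 := (inner_self_eq_norm_sq_to_K (𝕜 := ℂ)
    (∑ i, v i ⊗ₜ[ℂ] (stdOrthonormalBasis ℂ S i))).symm.trans h
  exact Complex.ofReal_injective (by rw [Complex.ofReal_pow]; exact h2)

theorem norm_rTensor_le {E F S : Type*} [NormedAddCommGroup E] [InnerProductSpace ℂ E]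
    [NormedAddCommGroup F] [InnerProductSpace ℂ F]
    [NormedAddCommGroup S] [InnerProductSpace ℂ S] [FiniteDimensional ℂ S]
    (T : E →L[ℂ] F) (x : E ⊗[ℂ] S) : ‖(T : E →ₗ[ℂ] F).rTensor S x‖ ≤ ‖T‖ * ‖x‖ := by
  obtain ⟨v, rfl⟩ : ∃ v : Fin (Module.finrank ℂ S) → E,
      x = ∑ i, v i ⊗ₜ[ℂ] (stdOrthonormalBasis ℂ S i) := by
    induction x with
    | zero => exact ⟨0, by simp⟩
    | add x y hx hy =>
      obtain ⟨v, rfl⟩ := hx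
      obtain ⟨w, rfl⟩ := hy
      exact ⟨v + w, by simp [TensorProduct.add_tmul, Finset.sum_add_distrib]⟩
    | tmul e s =>
      refine ⟨fun i => (stdOrthonormalBasis ℂ S).repr s i • e, ?_⟩
      conv_lhs => rw [← (stdOrthonormalBasis ℂ S).sum_repr s]
      simp [TensorProduct.tmul_sum, TensorProduct.smul_tmul]
  rw [← sq_le_sq₀ (norm_nonneg _) (by positivity), mul_pow, map_sum]
  simp only [LinearMap.rTensor_tmul, ContinuousLinearMap.coe_coe]
  rw [norm_sq_sum_tmul (fun i => T (v i)), norm_sq_sum_tmul v, Finset.mul_sum]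
  refine Finset.sum_le_sum fun i _ => ?_
  rw [← mul_pow]
  gcongr
  exact T.le_opNorm _

section L2

variable {A : Type*} [NonUnitalCStarAlgebra A] [PartialOrder A] [StarOrderedRing A]

/-- The Hilbert space `L²(A, τ) ⊗ S`, where `L²(A, τ)` is the GNS space. -/
def L2Tensor (τ : A →ₚ[ℂ] ℂ) (S : Type*) [NormedAddCommGroup S] [InnerProductSpace ℂ S] :
    Type _ := UniformSpace.Completion (τ.GNS ⊗[ℂ] S)

namespace L2Tensor

variable (τ : A →ₚ[ℂ] ℂ) {S : Type*} [NormedAddCommGroup S] [InnerProductSpace ℂ S]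

instance : NormedAddCommGroup (L2Tensor τ S) :=
  inferInstanceAs (NormedAddCommGroup (UniformSpace.Completion (τ.GNS ⊗[ℂ] S)))

instance : InnerProductSpace ℂ (L2Tensor τ S) :=
  inferInstanceAs (InnerProductSpace ℂ (UniformSpace.Completion (τ.GNS ⊗[ℂ] S)))

instance : CompleteSpace (L2Tensor τ S) :=
  inferInstanceAs (CompleteSpace (UniformSpace.Completion (τ.GNS ⊗[ℂ] S)))

/-- The canonical isometry from the algebraic tensor product with dense range. -/
def ofTensor : τ.GNS ⊗[ℂ] S →ₗᵢ[ℂ] L2Tensor τ S :=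
  (UniformSpace.Completion.toComplₗᵢ : _ →ₗᵢ[ℂ] UniformSpace.Completion (τ.GNS ⊗[ℂ] S))

/-- The vector `Λ(a) ⊗ ξ`. -/
def vec (a : A) (ξ : S) : L2Tensor τ S :=
  ofTensor τ ((τ.toPreGNS a : τ.GNS) ⊗ₜ[ℂ] ξ)

/-- The representation of `A` on `L²(A, τ) ⊗ S` by left multiplication,
`π(a) (Λ(b) ⊗ ξ) = Λ(ab) ⊗ ξ`. -/
def leftMul [FiniteDimensional ℂ S] (a : A) : L2Tensor τ S →L[ℂ] L2Tensor τ S :=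
  ((((τ.gnsNonUnitalStarAlgHom a : τ.GNS →ₗ[ℂ] τ.GNS).rTensor S).mkContinuous
    ‖τ.gnsNonUnitalStarAlgHom a‖ (norm_rTensor_le _)).completion :
      UniformSpace.Completion (τ.GNS ⊗[ℂ] S) →L[ℂ] UniformSpace.Completion (τ.GNS ⊗[ℂ] S))

theorem leftMul_ofTensor [FiniteDimensional ℂ S] (a : A) (x : τ.GNS ⊗[ℂ] S) :
    leftMul τ a (ofTensor τ x) =
      ofTensor τ ((τ.gnsNonUnitalStarAlgHom a : τ.GNS →ₗ[ℂ] τ.GNS).rTensor S x) :=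
  UniformSpace.Completion.map_coe (ContinuousLinearMap.uniformContinuous _) _

theorem leftMul_vec [FiniteDimensional ℂ S] (a b : A) (ξ : S) :
    leftMul τ a (vec τ b ξ) = vec τ (a * b) ξ := by
  simp [leftMul_ofTensor, vec]

end L2Tensor

end L2

/-! ### Inductive limits of Hilbert spaces along isometries -/

section HilbertLimit

variable {E : ℕ → Type*} [∀ n, NormedAddCommGroup (E n)] [∀ n, InnerProductSpace ℂ (E n)]

/-- The composite `V_{n,k} = V_{k-1} ∘ ⋯ ∘ V_n` for `n ≤ k`. -/
def isometryTo (V : ∀ n, E n →ₗᵢ[ℂ] E (n + 1)) {n k : ℕ} (h : n ≤ k) : E n →ₗᵢ[ℂ] E k :=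
  Nat.leRecOn (C := fun k => E n →ₗᵢ[ℂ] E k) h (fun {k} f => (V k).comp f) LinearIsometry.id

theorem isometryTo_self (V : ∀ n, E n →ₗᵢ[ℂ] E (n + 1)) (n : ℕ) (x : E n) :
    isometryTo V le_rfl x = x := by
  rw [isometryTo, Nat.leRecOn_self]
  rfl

theorem isometryTo_succ (V : ∀ n, E n →ₗᵢ[ℂ] E (n + 1)) {n k : ℕ} (h : n ≤ k) (x : E n) :
    isometryTo V (Nat.le_succ_of_le h) x = V k (isometryTo V h x) := by
  rw [isometryTo, Nat.leRecOn_succ h]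
  rfl

/-- Sequences that are eventually compatible with the isometries: they represent the elements of
the algebraic inductive limit. -/
def preHilbertSubmodule (V : ∀ n, E n →ₗᵢ[ℂ] E (n + 1)) : Submodule ℂ (∀ n, E n) where
  carrier := {f | ∀ᶠ n in atTop, f (n + 1) = V n (f n)}
  add_mem' := fun {f g} hf hg => by
    filter_upwards [hf, hg] with n h1 h2
    simp [h1, h2]
  zero_mem' := Eventually.of_forall fun n => by simp
  smul_mem' := fun c f hf => by
    filter_upwards [hf] with n h1
    simp [h1]

/-- The algebraic inductive limit (before identifying eventually equal sequences). -/
def PreHilbertLimit (V : ∀ n, E n →ₗᵢ[ℂ] E (n + 1)) : Type _ := preHilbertSubmodule V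

namespace PreHilbertLimit

variable {V : ∀ n, E n →ₗᵢ[ℂ] E (n + 1)}

instance : AddCommGroup (PreHilbertLimit V) :=
  inferInstanceAs (AddCommGroup (preHilbertSubmodule V))

instance : Module ℂ (PreHilbertLimit V) := inferInstanceAs (Module ℂ (preHilbertSubmodule V))

/-- The underlying sequence. -/
def seq : PreHilbertLimit V →ₗ[ℂ] (∀ n, E n) := (preHilbertSubmodule V).subtype

/-- The (eventually constant) limit of the inner products. -/
def limInner (f g : PreHilbertLimit V) : ℂ :=
  limUnder atTop fun n => ⟪seq f n, seq g n⟫_ℂ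

theorem eventually_inner (f g : PreHilbertLimit V) :
    ∀ᶠ n in atTop, ⟪seq f n, seq g n⟫_ℂ = limInner f g := by
  obtain ⟨N, hN⟩ := eventually_atTop.1 (f.2.and g.2)
  have h : ∀ n ≥ N, ⟪seq f n, seq g n⟫_ℂ = ⟪seq f N, seq g N⟫_ℂ := by
    intro n hn
    induction n, hn using Nat.le_induction with
    | base => rfl
    | succ n hn ih =>
      obtain ⟨h1, h2⟩ := hN n hn
      have h1' : seq f (n + 1) = V n (seq f n) := h1
      have h2' : seq g (n + 1) = V n (seq g n) := h2
      rw [h1', h2', LinearIsometry.inner_map_map, ih]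
  have h2 : Tendsto (fun n => ⟪seq f n, seq g n⟫_ℂ) atTop (𝓝 ⟪seq f N, seq g N⟫_ℂ) :=
    tendsto_const_nhds.congr' (eventually_atTop.2 ⟨N, fun n hn => (h n hn).symm⟩)
  filter_upwards [eventually_ge_atTop N] with n hn
  rw [h n hn, limInner, h2.limUnder_eq]

/-- The inner product on the algebraic inductive limit. -/
abbrev core : PreInnerProductSpace.Core ℂ (PreHilbertLimit V) where
  inner := limInner
  conj_inner_symm f g := by
    obtain ⟨n, h1, h2⟩ := ((eventually_inner f g).and (eventually_inner g f)).exists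
    rw [← h1, ← h2, inner_conj_symm]
  re_inner_nonneg f := by
    obtain ⟨n, h1⟩ := (eventually_inner f f).exists
    rw [← h1]
    exact inner_self_nonneg
  add_left f g k := by
    obtain ⟨n, h1, h2, h3⟩ := ((eventually_inner (f + g) k).and
      ((eventually_inner f k).and (eventually_inner g k))).exists
    rw [← h1, ← h2, ← h3, map_add, Pi.add_apply, inner_add_left]
  smul_left f g c := by
    obtain ⟨n, h1, h2⟩ := ((eventually_inner (c • f) g).and (eventually_inner f g)).exists
    rw [← h1, ← h2, map_smul, Pi.smul_apply, inner_smul_left]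

instance : SeminormedAddCommGroup (PreHilbertLimit V) :=
  InnerProductSpace.Core.toSeminormedAddCommGroup (c := core)

instance : InnerProductSpace ℂ (PreHilbertLimit V) := InnerProductSpace.ofCore core

theorem inner_def (f g : PreHilbertLimit V) : ⟪f, g⟫_ℂ = limInner f g := rfl

end PreHilbertLimit

/-- The Hilbert space inductive limit `lim (E_n, V_n)`. -/
def HilbertLimit (V : ∀ n, E n →ₗᵢ[ℂ] E (n + 1)) : Type _ :=
  UniformSpace.Completion (PreHilbertLimit V)

variable (V : ∀ n, E n →ₗᵢ[ℂ] E (n + 1))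

instance : NormedAddCommGroup (HilbertLimit V) :=
  inferInstanceAs (NormedAddCommGroup (UniformSpace.Completion (PreHilbertLimit V)))

instance : InnerProductSpace ℂ (HilbertLimit V) :=
  inferInstanceAs (InnerProductSpace ℂ (UniformSpace.Completion (PreHilbertLimit V)))

instance : CompleteSpace (HilbertLimit V) :=
  inferInstanceAs (CompleteSpace (UniformSpace.Completion (PreHilbertLimit V)))

/-- The canonical isometry from the algebraic inductive limit with dense range. -/
def ofPreHilbertLimit : PreHilbertLimit V →ₗᵢ[ℂ] HilbertLimit V :=
  (UniformSpace.Completion.toComplₗᵢ : _ →ₗᵢ[ℂ] UniformSpace.Completion (PreHilbertLimit V))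

/-- The compatible sequence `(0, …, 0, x, V_n x, V_{n,n+2} x, …)` issued from `x ∈ E_n`. -/
def toPreHilbertLimit (n : ℕ) : E n →ₗ[ℂ] PreHilbertLimit V where
  toFun x := ⟨fun k => if h : n ≤ k then isometryTo V h x else 0, by
    filter_upwards [eventually_ge_atTop n] with k hk
    rw [dif_pos hk, dif_pos (Nat.le_succ_of_le hk), isometryTo_succ]⟩
  map_add' x y := Subtype.ext <| funext fun k => by
    change (if h : n ≤ k then isometryTo V h (x + y) else 0) =
      (if h : n ≤ k then isometryTo V h x else 0) + (if h : n ≤ k then isometryTo V h y else 0)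
    split_ifs <;> simp
  map_smul' c x := Subtype.ext <| funext fun k => by
    change (if h : n ≤ k then isometryTo V h (c • x) else 0) =
      c • (if h : n ≤ k then isometryTo V h x else 0)
    split_ifs <;> simp

/-- The canonical isometry `V_{n,∞} : E_n → lim (E_n, V_n)`. -/
def toHilbertLimit (n : ℕ) : E n →ₗᵢ[ℂ] HilbertLimit V :=
  (ofPreHilbertLimit V).comp
    ((toPreHilbertLimit V n).isometryOfInner fun x y => by
      rw [PreHilbertLimit.inner_def]
      obtain ⟨k, h1, h2⟩ := ((PreHilbertLimit.eventually_inner (toPreHilbertLimit V n x)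
        (toPreHilbertLimit V n y)).and (eventually_ge_atTop n)).exists
      rw [← h1]
      have h : ∀ z, PreHilbertLimit.seq (toPreHilbertLimit V n z) k = isometryTo V h2 z :=
        fun z => dif_pos h2
      rw [h, h, LinearIsometry.inner_map_map])

end HilbertLimit

/-! ### Inductive limits of `C*`-algebras -/

section CStarLimit

variable {B : ℕ → Type*} [∀ n, NonUnitalCStarAlgebra (B n)]

/-- The composite `φ_{n,k} = φ_{k-1} ∘ ⋯ ∘ φ_n` for `n ≤ k`. -/
def homTo (φ : ∀ n, B n →⋆ₙₐ[ℂ] B (n + 1)) {n k : ℕ} (h : n ≤ k) : B n →⋆ₙₐ[ℂ] B k :=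
  Nat.leRecOn (C := fun k => B n →⋆ₙₐ[ℂ] B k) h (fun {k} f => (φ k).comp f)
    (NonUnitalStarAlgHom.id ℂ (B n))

theorem homTo_self (φ : ∀ n, B n →⋆ₙₐ[ℂ] B (n + 1)) (n : ℕ) (x : B n) :
    homTo φ le_rfl x = x := by
  rw [homTo, Nat.leRecOn_self]
  rfl

theorem homTo_succ (φ : ∀ n, B n →⋆ₙₐ[ℂ] B (n + 1)) {n k : ℕ} (h : n ≤ k) (x : B n) :
    homTo φ (Nat.le_succ_of_le h) x = φ k (homTo φ h x) := by
  rw [homTo, Nat.leRecOn_succ h]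
  rfl

theorem homTo_trans (φ : ∀ n, B n →⋆ₙₐ[ℂ] B (n + 1)) {n k l : ℕ} (h : n ≤ k) (h' : k ≤ l)
    (x : B n) : homTo φ h' (homTo φ h x) = homTo φ (h.trans h') x := by
  induction l, h' using Nat.le_induction with
  | base => rw [homTo_self]
  | succ l hl ih => rw [homTo_succ φ hl, ih, homTo_succ φ (h.trans hl)]

/-- A sequence `f_n ∈ B_n` is asymptotically compatible with the connecting maps if
`sup_{k ≥ n} ‖f_k - φ_{n,k}(f_n)‖ → 0` as `n → ∞`. -/
def IsAsymptotic (φ : ∀ n, B n →⋆ₙₐ[ℂ] B (n + 1)) (f : ∀ n, B n) : Prop :=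
  ∀ ε > 0, ∃ N, ∀ n ≥ N, ∀ k, ∀ h : n ≤ k, ‖f k - homTo φ h (f n)‖ ≤ ε

variable {φ : ∀ n, B n →⋆ₙₐ[ℂ] B (n + 1)}

theorem norm_homTo_le {n k : ℕ} (h : n ≤ k) (x : B n) : ‖homTo φ h x‖ ≤ ‖x‖ :=
  NonUnitalStarAlgHom.norm_apply_le _ _

theorem IsAsymptotic.bound {f : ∀ n, B n} (hf : IsAsymptotic φ f) :
    ∃ C > 0, ∃ N, ∀ n ≥ N, ‖f n‖ ≤ C := by
  obtain ⟨N, hN⟩ := hf 1 one_pos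
  refine ⟨‖f N‖ + 1, by positivity, N, fun n hn => ?_⟩
  have h1 := hN N le_rfl n hn
  have h2 := norm_homTo_le (φ := φ) hn (f N)
  have h3 := norm_le_norm_add_norm_sub' (f n) (homTo φ hn (f N))
  linarith

theorem IsAsymptotic.tendsto_norm {f : ∀ n, B n} (hf : IsAsymptotic φ f) :
    ∃ l, Tendsto (fun n => ‖f n‖) atTop (𝓝 l) := by
  obtain ⟨C, -, N₀, hC⟩ := hf.bound
  have hb : IsBoundedUnder (· ≤ ·) atTop fun n => ‖f n‖ :=
    ⟨C, eventually_map.2 (eventually_atTop.2 ⟨N₀, hC⟩)⟩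
  have hb' : IsBoundedUnder (· ≥ ·) atTop fun n => ‖f n‖ :=
    ⟨0, eventually_map.2 (Eventually.of_forall fun n => norm_nonneg _)⟩
  refine ⟨_, tendsto_of_le_liminf_of_limsup_le (a := limsup (fun n => ‖f n‖) atTop) ?_ le_rfl
    hb hb'⟩
  refine le_of_forall_pos_le_add fun ε hε => ?_
  obtain ⟨N, hN⟩ := hf ε hε
  rw [← sub_le_iff_le_add]
  refine le_liminf_of_le hb.isCoboundedUnder_ge (eventually_atTop.2 ⟨N, fun n hn => ?_⟩)
  rw [sub_le_iff_le_add]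
  refine limsup_le_of_le hb'.isCoboundedUnder_le (eventually_atTop.2 ⟨n, fun k hk => ?_⟩)
  have h1 := hN n hn k hk
  have h2 := norm_homTo_le (φ := φ) hk (f n)
  have h3 := norm_le_norm_add_norm_sub' (f k) (homTo φ hk (f n))
  linarith

variable (φ) in
/-- The `*`-algebra of asymptotically compatible sequences. -/
def asymptoticSubalgebra : NonUnitalStarSubalgebra ℂ (∀ n, B n) where
  carrier := {f | IsAsymptotic φ f}
  add_mem' := fun {f g} hf hg ε hε => by
    obtain ⟨N, hN⟩ := hf (ε / 2) (half_pos hε)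
    obtain ⟨M, hM⟩ := hg (ε / 2) (half_pos hε)
    refine ⟨max N M, fun n hn k h => ?_⟩
    have h1 := hN n (le_of_max_le_left hn) k h
    have h2 := hM n (le_of_max_le_right hn) k h
    rw [Pi.add_apply, Pi.add_apply, map_add, add_sub_add_comm]
    exact (norm_add_le _ _).trans (by linarith)
  zero_mem' := fun ε hε => ⟨0, fun n _ k h => by simpa using hε.le⟩
  mul_mem' := fun {f g} hf hg ε hε => by
    obtain ⟨C, hC, N₁, h₁⟩ := IsAsymptotic.bound hf
    obtain ⟨D, hD, N₂, h₂⟩ := IsAsymptotic.bound hg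
    obtain ⟨N₃, h₃⟩ := hf (ε / 2 / D) (by positivity)
    obtain ⟨N₄, h₄⟩ := hg (ε / 2 / C) (by positivity)
    refine ⟨max (max N₁ N₂) (max N₃ N₄), fun n hn k h => ?_⟩
    simp only [ge_iff_le, max_le_iff] at hn
    have e : f k * g k - homTo φ h (f n) * homTo φ h (g n) =
        (f k - homTo φ h (f n)) * g k + homTo φ h (f n) * (g k - homTo φ h (g n)) := by
      rw [sub_mul, mul_sub]
      abel
    rw [Pi.mul_apply, Pi.mul_apply, map_mul, e]
    have i1 : ‖(f k - homTo φ h (f n)) * g k‖ ≤ ε / 2 / D * D :=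
      (norm_mul_le _ _).trans (mul_le_mul (h₃ n hn.2.1 k h) (h₂ k (hn.1.2.trans h))
        (norm_nonneg _) (by positivity))
    have i2 : ‖homTo φ h (f n) * (g k - homTo φ h (g n))‖ ≤ C * (ε / 2 / C) :=
      (norm_mul_le _ _).trans (mul_le_mul ((norm_homTo_le h _).trans (h₁ n hn.1.1))
        (h₄ n hn.2.2 k h) (norm_nonneg _) hC.le)
    rw [div_mul_cancel₀ _ hD.ne'] at i1
    rw [mul_div_cancel₀ _ hC.ne'] at i2
    exact (norm_add_le _ _).trans (by linarith)
  smul_mem' := fun c f hf ε hε => by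
    obtain ⟨N, hN⟩ := hf (ε / (‖c‖ + 1)) (by positivity)
    refine ⟨N, fun n hn k h => ?_⟩
    rw [Pi.smul_apply, Pi.smul_apply, map_smul, ← smul_sub, norm_smul]
    have h1 : ‖c‖ * ‖f k - homTo φ h (f n)‖ ≤ (‖c‖ + 1) * (ε / (‖c‖ + 1)) :=
      mul_le_mul (by linarith) (hN n hn k h) (norm_nonneg _) (by positivity)
    rwa [mul_div_cancel₀ _ (by positivity)] at h1
  star_mem' := fun {f} hf ε hε => by
    obtain ⟨N, hN⟩ := hf ε hε
    refine ⟨N, fun n hn k h => ?_⟩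
    rw [Pi.star_apply, Pi.star_apply, map_star, ← star_sub, norm_star]
    exact hN n hn k h

variable (φ) in
/-- Asymptotically compatible sequences with the seminorm `lim_n ‖f_n‖`. -/
def AsymptoticSeq : Type _ := asymptoticSubalgebra φ

namespace AsymptoticSeq

instance : NonUnitalRing (AsymptoticSeq φ) :=
  inferInstanceAs (NonUnitalRing (asymptoticSubalgebra φ))

instance : Module ℂ (AsymptoticSeq φ) := inferInstanceAs (Module ℂ (asymptoticSubalgebra φ))

instance : IsScalarTower ℂ (AsymptoticSeq φ) (AsymptoticSeq φ) :=
  inferInstanceAs (IsScalarTower ℂ (asymptoticSubalgebra φ) (asymptoticSubalgebra φ))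

instance : SMulCommClass ℂ (AsymptoticSeq φ) (AsymptoticSeq φ) :=
  inferInstanceAs (SMulCommClass ℂ (asymptoticSubalgebra φ) (asymptoticSubalgebra φ))

instance : StarRing (AsymptoticSeq φ) := inferInstanceAs (StarRing (asymptoticSubalgebra φ))

instance : StarModule ℂ (AsymptoticSeq φ) :=
  inferInstanceAs (StarModule ℂ (asymptoticSubalgebra φ))

/-- The underlying sequence. -/
def seq (f : AsymptoticSeq φ) : ∀ n, B n := f.1

/-- The seminorm `lim_n ‖f_n‖`. -/
def limNorm (f : AsymptoticSeq φ) : ℝ := limUnder atTop fun n => ‖seq f n‖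

theorem tendsto_limNorm (f : AsymptoticSeq φ) :
    Tendsto (fun n => ‖seq f n‖) atTop (𝓝 (limNorm f)) := by
  obtain ⟨l, hl⟩ := IsAsymptotic.tendsto_norm f.2
  have h : limNorm f = l := hl.limUnder_eq
  rw [h]
  exact hl

instance : SeminormedAddCommGroup (AsymptoticSeq φ) :=
  AddGroupSeminorm.toSeminormedAddCommGroup
    { toFun := limNorm
      map_zero' := tendsto_nhds_unique (tendsto_limNorm 0)
        (tendsto_const_nhds.congr fun n => (norm_zero (E := B n)).symm)
      add_le' := fun f g => le_of_tendsto_of_tendsto' (tendsto_limNorm (f + g))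
        ((tendsto_limNorm f).add (tendsto_limNorm g)) fun n => norm_add_le (seq f n) (seq g n)
      neg' := fun f => tendsto_nhds_unique (tendsto_limNorm (-f))
        ((tendsto_limNorm f).congr fun n => (norm_neg (seq f n)).symm) }

theorem tendsto_norm (f : AsymptoticSeq φ) : Tendsto (fun n => ‖seq f n‖) atTop (𝓝 ‖f‖) :=
  tendsto_limNorm f

instance : NonUnitalSeminormedRing (AsymptoticSeq φ) where
  norm_mul_le f g := le_of_tendsto_of_tendsto' (tendsto_norm (f * g))
    ((tendsto_norm f).mul (tendsto_norm g)) fun n => norm_mul_le (seq f n) (seq g n)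
  dist_eq _ _ := rfl

instance : NormedSpace ℂ (AsymptoticSeq φ) where
  norm_smul_le c f := (tendsto_nhds_unique (tendsto_norm (c • f))
    (((tendsto_norm f).const_mul ‖c‖).congr fun n => (norm_smul c (seq f n)).symm)).le

theorem norm_star_eq (f : AsymptoticSeq φ) : ‖star f‖ = ‖f‖ :=
  tendsto_nhds_unique (tendsto_norm (star f))
    ((tendsto_norm f).congr fun n => (norm_star (seq f n)).symm)

theorem norm_star_mul_self_eq (f : AsymptoticSeq φ) : ‖star f * f‖ = ‖f‖ * ‖f‖ :=
  tendsto_nhds_unique (tendsto_norm (star f * f))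
    (((tendsto_norm f).mul (tendsto_norm f)).congr fun n =>
      (CStarRing.norm_star_mul_self (x := seq f n)).symm)

theorem seq_sub (f g : AsymptoticSeq φ) (k : ℕ) : seq (f - g) k = seq f k - seq g k := rfl

/-- The element given by an asymptotically compatible sequence. -/
def ofSeq (f : ∀ n, B n) (hf : IsAsymptotic φ f) : AsymptoticSeq φ := ⟨f, hf⟩

theorem seq_ofSeq (f : ∀ n, B n) (hf : IsAsymptotic φ f) (k : ℕ) : seq (ofSeq f hf) k = f k := rfl

theorem isAsymptotic_seq (f : AsymptoticSeq φ) : IsAsymptotic φ (seq f) := f.2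

theorem exists_limit (F : ℕ → AsymptoticSeq φ)
    (hF' : ∀ i j, i ≤ j → ‖F i - F j‖ < (1 / 2 : ℝ) ^ i) :
    ∃ f : AsymptoticSeq φ, ∀ j, ‖F j - f‖ ≤ (1 / 2 : ℝ) ^ j := by
  have hN : ∀ j, ∃ N, (∀ n ≥ N, ∀ k, ∀ h : n ≤ k,
      ‖seq (F j) k - homTo φ h (seq (F j) n)‖ ≤ (1 / 2 : ℝ) ^ j) ∧
      ∀ k ≥ N, ∀ i ≤ j,
        ‖seq (F i) k - seq (F j) k‖ ≤ (1 / 2 : ℝ) ^ i := by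
    intro j
    obtain ⟨N₁, h₁⟩ := isAsymptotic_seq (F j) ((1 / 2 : ℝ) ^ j) (by positivity)
    have h₂ : ∀ᶠ k in atTop, ∀ i ∈ Finset.range (j + 1),
        ‖seq (F i) k - seq (F j) k‖ ≤ (1 / 2 : ℝ) ^ i := by
      rw [Filter.eventually_all_finset]
      intro i hi
      filter_upwards [(tendsto_norm (F i - F j)).eventually_lt_const
        (hF' i j (Nat.lt_succ_iff.1 (Finset.mem_range.1 hi)))] with k hk
      rw [seq_sub] at hk
      exact hk.le
    obtain ⟨N₂, h₂⟩ := eventually_atTop.1 h₂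
    exact ⟨max N₁ N₂, fun n hn k h => h₁ n (le_of_max_le_left hn) k h,
      fun k hk i hi => h₂ k (le_of_max_le_right hk) i (Finset.mem_range.2 (Nat.lt_succ_iff.2 hi))⟩
  choose N hN₁ hN₂ using hN
  obtain ⟨J, hJ, hmono⟩ : ∃ J : ℕ → ℕ,
      (∀ j k, max (N j) j ≤ k → j ≤ J k ∧ N (J k) ≤ k) ∧ Monotone J := by
    refine ⟨fun k => Nat.findGreatest (fun j => N j ≤ k) k, fun j k hk => ?_, fun n k h =>
      Nat.findGreatest_mono (fun j hj => le_trans hj h) h⟩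
    have h1 : j ≤ k := le_of_max_le_right hk
    have h2 : N j ≤ k := le_of_max_le_left hk
    exact ⟨Nat.le_findGreatest h1 h2, Nat.findGreatest_spec (P := fun j => N j ≤ k) h1 h2⟩
  have hpow : ∀ i j : ℕ, j ≤ i → (1 / 2 : ℝ) ^ i ≤ (1 / 2 : ℝ) ^ j := fun i j h =>
    pow_le_pow_of_le_one (by norm_num) (by norm_num) h
  have hf : IsAsymptotic φ (fun k => seq (F (J k)) k) := by
    intro ε hε
    obtain ⟨j, hj⟩ := exists_pow_lt_of_lt_one (half_pos hε) (by norm_num : (1 / 2 : ℝ) < 1)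
    refine ⟨max (N j) j, fun n hn k h => ?_⟩
    obtain ⟨h1, h2⟩ := hJ j n hn
    obtain ⟨h3, h4⟩ := hJ j k (le_trans hn h)
    have i1 := hN₁ (J n) n h2 k h
    have i2 := hN₂ (J k) k h4 (J n) (hmono h)
    have i3 := norm_sub_le_norm_sub_add_norm_sub (seq (F (J k)) k)
      (seq (F (J n)) k) (homTo φ h (seq (F (J n)) n))
    rw [norm_sub_rev] at i2
    have i4 := hpow (J n) j h1
    change ‖seq (F (J k)) k - homTo φ h (seq (F (J n)) n)‖ ≤ ε
    linarith
  refine ⟨ofSeq _ hf, fun j => le_of_tendsto (tendsto_norm _) ?_⟩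
  filter_upwards [eventually_ge_atTop (max (N j) j)] with k hk
  obtain ⟨h1, h2⟩ := hJ j k hk
  rw [seq_sub, seq_ofSeq]
  exact hN₂ (J k) k h2 j h1

end AsymptoticSeq

variable (φ) in
/-- The `C*`-algebraic inductive limit `lim (B_n, φ_n)`: asymptotically compatible sequences modulo
the sequences `f` with `‖f_n‖ → 0`, with the norm `lim_n ‖f_n‖`. -/
def CStarLimit : Type _ := SeparationQuotient (AsymptoticSeq φ)

namespace CStarLimit

instance : NonUnitalNormedRing (CStarLimit φ) :=
  inferInstanceAs (NonUnitalNormedRing (SeparationQuotient (AsymptoticSeq φ)))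

instance : NormedSpace ℂ (CStarLimit φ) :=
  inferInstanceAs (NormedSpace ℂ (SeparationQuotient (AsymptoticSeq φ)))

instance : IsScalarTower ℂ (CStarLimit φ) (CStarLimit φ) where
  smul_assoc c x y := by
    obtain ⟨f, rfl⟩ := SeparationQuotient.surjective_mk x
    obtain ⟨g, rfl⟩ := SeparationQuotient.surjective_mk y
    exact congrArg SeparationQuotient.mk (smul_mul_assoc c f g)

instance : SMulCommClass ℂ (CStarLimit φ) (CStarLimit φ) where
  smul_comm c x y := by
    obtain ⟨f, rfl⟩ := SeparationQuotient.surjective_mk x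
    obtain ⟨g, rfl⟩ := SeparationQuotient.surjective_mk y
    exact congrArg SeparationQuotient.mk (mul_smul_comm c f g).symm

/-- The class of an asymptotically compatible sequence. -/
def mk (f : AsymptoticSeq φ) : CStarLimit φ := SeparationQuotient.mk f

theorem mk_surjective : Function.Surjective (mk : AsymptoticSeq φ → CStarLimit φ) :=
  SeparationQuotient.surjective_mk

theorem norm_mk (f : AsymptoticSeq φ) : ‖mk f‖ = ‖f‖ := rfl

instance : Star (CStarLimit φ) where
  star := SeparationQuotient.lift (fun f => mk (star f)) fun f g h => by
    refine SeparationQuotient.mk_eq_mk.2 ?_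
    rw [Metric.inseparable_iff, dist_eq_norm] at h ⊢
    rw [← star_sub, AsymptoticSeq.norm_star_eq, h]

theorem star_mk (f : AsymptoticSeq φ) : star (mk f) = mk (star f) := rfl

instance : StarRing (CStarLimit φ) where
  star_involutive x := by
    obtain ⟨f, rfl⟩ := mk_surjective x
    exact congrArg mk (star_star f)
  star_mul x y := by
    obtain ⟨f, rfl⟩ := mk_surjective x
    obtain ⟨g, rfl⟩ := mk_surjective y
    exact congrArg mk (star_mul f g)
  star_add x y := by
    obtain ⟨f, rfl⟩ := mk_surjective x
    obtain ⟨g, rfl⟩ := mk_surjective y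
    exact congrArg mk (star_add f g)

instance : StarModule ℂ (CStarLimit φ) where
  star_smul c x := by
    obtain ⟨f, rfl⟩ := mk_surjective x
    exact congrArg mk (star_smul c f)

instance : CStarRing (CStarLimit φ) where
  norm_mul_self_le x := by
    obtain ⟨f, rfl⟩ := mk_surjective x
    exact (AsymptoticSeq.norm_star_mul_self_eq f).ge

instance : CompleteSpace (CStarLimit φ) := by
  refine Metric.complete_of_convergent_controlled_sequences (fun n => (1 / 2 : ℝ) ^ n)
    (fun n => by positivity) fun u hu => ?_
  choose F hF using fun j => mk_surjective (u j)
  have hsub : ∀ f g : AsymptoticSeq φ, ‖mk f - mk g‖ = ‖f - g‖ := fun f g => norm_mk (f - g)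
  obtain ⟨f, hf⟩ := AsymptoticSeq.exists_limit F fun i j hij => by
    have h := hu i i j le_rfl hij
    rwa [← hF i, ← hF j, dist_eq_norm, hsub] at h
  refine ⟨mk f, ?_⟩
  rw [tendsto_iff_norm_sub_tendsto_zero]
  refine squeeze_zero (fun j => norm_nonneg _) (fun j => ?_)
    (tendsto_pow_atTop_nhds_zero_of_lt_one (by norm_num) (by norm_num : (1 / 2 : ℝ) < 1))
  rw [← hF j, hsub]
  exact hf j

instance : NonUnitalCStarAlgebra (CStarLimit φ) where

variable (φ) in
/-- The canonical map `ι_n : B_n → lim (B_n, φ_n)`. -/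
def of (n : ℕ) : B n →⋆ₙₐ[ℂ] CStarLimit φ where
  toFun b := mk <| .ofSeq (fun k => if h : n ≤ k then homTo φ h b else 0) fun ε hε =>
    ⟨n, fun j hj k h => by
      beta_reduce
      rw [dif_pos (show n ≤ j from hj), dif_pos (show n ≤ k from le_trans hj h), homTo_trans,
        sub_self, norm_zero]
      exact hε.le⟩
  map_smul' c x := congrArg mk <| Subtype.ext <| funext fun k => by
    change (if h : n ≤ k then homTo φ h (c • x) else 0) =
      c • (if h : n ≤ k then homTo φ h x else 0)
    split_ifs <;> simp
  map_zero' := congrArg mk <| Subtype.ext <| funext fun k => by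
    change (if h : n ≤ k then homTo φ h 0 else 0) = 0
    split_ifs <;> simp
  map_add' x y := congrArg mk <| Subtype.ext <| funext fun k => by
    change (if h : n ≤ k then homTo φ h (x + y) else 0) =
      (if h : n ≤ k then homTo φ h x else 0) + (if h : n ≤ k then homTo φ h y else 0)
    split_ifs <;> simp
  map_mul' x y := congrArg mk <| Subtype.ext <| funext fun k => by
    change (if h : n ≤ k then homTo φ h (x * y) else 0) =
      (if h : n ≤ k then homTo φ h x else 0) * (if h : n ≤ k then homTo φ h y else 0)
    split_ifs <;> simp
  map_star' x := congrArg mk <| Subtype.ext <| funext fun k => by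
    change (if h : n ≤ k then homTo φ h (star x) else 0) =
      star (if h : n ≤ k then homTo φ h x else 0)
    split_ifs <;> simp [map_star]

end CStarLimit

end CStarLimit

/-! ### Unbounded operators -/

section Unbounded

variable {E F H : Type*} [NormedAddCommGroup E] [InnerProductSpace ℂ E]
  [NormedAddCommGroup F] [InnerProductSpace ℂ F] [NormedAddCommGroup H] [InnerProductSpace ℂ H]

/-- `V (dom D) ⊆ dom D'` and `D' V = V D` on `dom D`. -/
def Intertwines (V : E →ₗᵢ[ℂ] F) (D : E →ₗ.[ℂ] E) (D' : F →ₗ.[ℂ] F) : Prop :=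
  ∀ x : D.domain, ∃ h : V x ∈ D'.domain, D' ⟨V x, h⟩ = V (D x)

/-- The commutator `[D, a]` is defined on `dom D` (that is, `a (dom D) ⊆ dom D`) and extends to the
bounded operator `T`. -/
def CommutatorExtendsTo (D : H →ₗ.[ℂ] H) (a T : H →L[ℂ] H) : Prop :=
  ∀ x : D.domain, ∃ h : a x ∈ D.domain, D ⟨a x, h⟩ - a (D x) = T x

/-- `T` is the operator `(1 + D²)^{-1/2}`: `T` is positive and `T²` is the inverse of `1 + D²`
(with its natural domain). -/
def IsInvSqrtOneAddSq (D : H →ₗ.[ℂ] H) (T : H →L[ℂ] H) : Prop :=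
  T.IsPositive ∧ ∀ η : H, ∃ x y : D.domain, (x : H) = T (T η) ∧ (y : H) = D x ∧ (x : H) + D y = η

/-- The operator `(1 + D²)^{-1/2}` of a selfadjoint operator `D`. -/
def invSqrtOneAddSq (D : H →ₗ.[ℂ] H) : H →L[ℂ] H := Classical.epsilon (IsInvSqrtOneAddSq D)

variable [CompleteSpace H]

theorem exists_add_sq_eq {D : H →ₗ.[ℂ] H} (hD : IsSelfAdjoint D) (η : H) :
    ∃ x y : D.domain, (y : H) = D x ∧ (x : H) + D y = η := by
  let e := WithLp.prodContinuousLinearEquiv 2 ℂ H H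
  let G : Submodule ℂ (WithLp 2 (H × H)) := D.graph.comap (e : WithLp 2 (H × H) →ₗ[ℂ] H × H)
  have hG : IsClosed (G : Set (WithLp 2 (H × H))) := hD.isClosed.preimage e.continuous
  have : CompleteSpace G := hG.completeSpace_coe
  obtain ⟨g, hg, h, hh, hgh⟩ := G.exists_add_mem_mem_orthogonal (WithLp.toLp 2 (η, (0 : H)))
  have hg' : (g.fst, g.snd) ∈ D.graph := hg
  rw [LinearPMap.mem_graph_iff] at hg'
  obtain ⟨x, hx1, hx2⟩ := hg'
  simp only at hx1 hx2
  have e1 : η = g.fst + h.fst := congrArg WithLp.fst hgh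
  have e2 : 0 = g.snd + h.snd := congrArg WithLp.snd hgh
  have horth : ∀ z : D.domain, ⟪η - x, (z : H)⟫_ℂ = ⟪D x, D z⟫_ℂ := by
    intro z
    have hz : WithLp.toLp 2 ((z : H), D z) ∈ G := LinearPMap.mem_graph D z
    have := (Submodule.mem_orthogonal' G h).1 hh _ hz
    rw [WithLp.prod_inner_apply] at this
    have e3 : h.fst = η - x := by rw [e1, hx1]; abel
    have e4 : h.snd = - D x := by rw [hx2]; exact (neg_eq_of_add_eq_zero_right e2.symm).symm
    have h5 : ⟪h.fst, (z : H)⟫_ℂ + ⟪h.snd, D z⟫_ℂ = 0 := this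
    rw [e3, e4, inner_neg_left] at h5
    exact add_neg_eq_zero.1 h5
  have hadj : D.adjoint = D := hD
  have hy : D x ∈ D.adjoint.domain := D.mem_adjoint_domain_of_exists _ ⟨η - x, horth⟩
  have hy2 : D.adjoint ⟨D x, hy⟩ = η - x := LinearPMap.adjoint_apply_eq hD.dense_domain _ horth
  have hy' : D x ∈ D.domain := hadj.le.1 hy
  refine ⟨x, ⟨D x, hy'⟩, rfl, ?_⟩
  have : D ⟨D x, hy'⟩ = D.adjoint ⟨D x, hy⟩ := by
    have hle : D.adjoint ≤ D := hadj.le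
    exact (hle.2 (by rfl)).symm
  rw [this, hy2]
  abel

theorem inner_add_sq {D : H →ₗ.[ℂ] H} (hD : IsSelfAdjoint D) {x y : D.domain} (h : (y : H) = D x) :
    ⟪(x : H), (x : H) + D y⟫_ℂ = ((‖(x : H)‖ ^ 2 + ‖(y : H)‖ ^ 2 : ℝ) : ℂ) := by
  have hadj : D.adjoint = D := hD
  have hf : D.IsFormalAdjoint D := by
    have := LinearPMap.adjoint_isFormalAdjoint hD.dense_domain
    rwa [hadj] at this
  have h1 : ⟪D x, (y : H)⟫_ℂ = ⟪(x : H), D y⟫_ℂ := hf x y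
  rw [inner_add_right, ← h1, ← h, inner_self_eq_norm_sq_to_K (𝕜 := ℂ),
    inner_self_eq_norm_sq_to_K (𝕜 := ℂ)]
  push_cast
  rfl

theorem eq_of_add_sq_eq {D : H →ₗ.[ℂ] H} (hD : IsSelfAdjoint D) {x y x' y' : D.domain}
    (h : (y : H) = D x) (h' : (y' : H) = D x') (e : (x : H) + D y = x' + D y') : x = x' := by
  have h2 : ((y - y' : D.domain) : H) = D (x - x') := by
    rw [LinearPMap.map_sub, ← h, ← h']
    rfl
  have h1 := inner_add_sq hD h2
  have h3 : ((x - x' : D.domain) : H) + D (y - y') = 0 := by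
    rw [LinearPMap.map_sub, Submodule.coe_sub, sub_add_sub_comm, e, sub_self]
  rw [h3, inner_zero_right] at h1
  have h4 : (0 : ℝ) = ‖((x - x' : D.domain) : H)‖ ^ 2 + ‖((y - y' : D.domain) : H)‖ ^ 2 := by
    exact_mod_cast h1
  have h5 : ((x - x' : D.domain) : H) = 0 := by
    rw [← norm_eq_zero, ← sq_eq_zero_iff]
    nlinarith [sq_nonneg ‖((x - x' : D.domain) : H)‖, sq_nonneg ‖((y - y' : D.domain) : H)‖]
  exact sub_eq_zero.1 (Subtype.ext h5)

/-- For a selfadjoint operator `D`, the operator `(1 + D²)^{-1/2}` exists and is unique. -/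
theorem existsUnique_invSqrtOneAddSq {D : H →ₗ.[ℂ] H} (hD : IsSelfAdjoint D) :
    ∃! T, IsInvSqrtOneAddSq D T := by
  choose X Y hXY hη using exists_add_sq_eq hD
  have hn : ∀ η, ‖((X η : D.domain) : H)‖ ≤ 1 * ‖η‖ := by
    intro η
    have h1 := inner_add_sq hD (hXY η)
    rw [hη] at h1
    have h2 : ‖⟪((X η : D.domain) : H), η⟫_ℂ‖ = ‖(X η : H)‖ ^ 2 + ‖(Y η : H)‖ ^ 2 := by
      rw [h1, Complex.norm_real, Real.norm_of_nonneg (by positivity)]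
    have h3 := norm_inner_le_norm (𝕜 := ℂ) ((X η : D.domain) : H) η
    rw [h2] at h3
    by_contra hc
    nlinarith [norm_nonneg (X η : H), norm_nonneg η, sq_nonneg ‖(Y η : H)‖]
  let R : H →L[ℂ] H := LinearMap.mkContinuous
    { toFun := fun η => X η
      map_add' := fun a b => by
        rw [← Submodule.coe_add]
        refine congrArg _ (eq_of_add_sq_eq hD (hXY _) (y' := Y a + Y b) ?_ ?_)
        · rw [LinearPMap.map_add, ← hXY, ← hXY]
          rfl
        · rw [LinearPMap.map_add, hη, Submodule.coe_add, add_add_add_comm, hη, hη]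
      map_smul' := fun c a => by
        rw [RingHom.id_apply, ← Submodule.coe_smul]
        refine congrArg _ (eq_of_add_sq_eq hD (hXY _) (y' := c • Y a) ?_ ?_)
        · rw [LinearPMap.map_smul, ← hXY]
          rfl
        · rw [LinearPMap.map_smul, hη, Submodule.coe_smul, ← smul_add, hη] } 1 hn
  have hR : ∀ η, R η = X η := fun η => rfl
  have hpos : 0 ≤ R := by
    rw [ContinuousLinearMap.nonneg_iff_isPositive, ContinuousLinearMap.isPositive_iff_complex]
    intro η
    have h1 := inner_add_sq hD (hXY η)
    rw [hη] at h1
    rw [hR, h1]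
    exact ⟨congrArg _ (Complex.ofReal_re _), by rw [RCLike.re_to_complex, Complex.ofReal_re]; positivity⟩
  have huniq : ∀ T, IsInvSqrtOneAddSq D T → T * T = R := by
    rintro T ⟨-, hT⟩
    ext η
    obtain ⟨x, y, hx, hy, hxy⟩ := hT η
    have : x = X η := eq_of_add_sq_eq hD hy (hXY η) (by rw [hxy, hη])
    rw [hR, ← this, hx]
    rfl
  refine ⟨CFC.sqrt R, ⟨?_, fun η => ⟨X η, Y η, ?_, hXY η, hη η⟩⟩, fun T hT => ?_⟩
  · exact (ContinuousLinearMap.nonneg_iff_isPositive _).1 (CFC.sqrt_nonneg R)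
  · exact (congrArg (fun T : H →L[ℂ] H => T η) (CFC.sqrt_mul_sqrt_self R hpos)).symm
  · exact (CFC.sqrt_unique (huniq T hT)
      ((ContinuousLinearMap.nonneg_iff_isPositive _).2 hT.1)).symm

end Unbounded

/-! ### Locally compact spectral triples -/

/-- A representation is nondegenerate if the vectors `π(a) x` span a dense subspace. -/
def IsNondegenerateRep {A H : Type*} [NonUnitalCStarAlgebra A] [NormedAddCommGroup H]
    [InnerProductSpace ℂ H] [CompleteSpace H] (π : A →⋆ₙₐ[ℂ] (H →L[ℂ] H)) : Prop :=
  Dense (Submodule.span ℂ {y : H | ∃ a x, y = π a x} : Set H)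

/-- `π(a)(1 + D²)^{-1/2}` is compact for all `a ∈ 𝒜`. -/
def IsLocallyCompactOn {A H : Type*} [NonUnitalCStarAlgebra A] [NormedAddCommGroup H]
    [InnerProductSpace ℂ H] [CompleteSpace H] (𝒜 : NonUnitalStarSubalgebra ℂ A)
    (π : A →⋆ₙₐ[ℂ] (H →L[ℂ] H)) (D : H →ₗ.[ℂ] H) : Prop :=
  ∀ a ∈ 𝒜, IsCompactOperator (π a ∘L invSqrtOneAddSq D)

/-- `(𝒜, H, D)` is a locally compact (nonunital) spectral triple on the `C*`-algebra `A`, with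
representation `π`. -/
structure IsLocallyCompactSpectralTriple {A H : Type*} [NonUnitalCStarAlgebra A]
    [NormedAddCommGroup H] [InnerProductSpace ℂ H] [CompleteSpace H]
    (𝒜 : NonUnitalStarSubalgebra ℂ A) (π : A →⋆ₙₐ[ℂ] (H →L[ℂ] H)) (D : H →ₗ.[ℂ] H) : Prop where
  faithful : Function.Injective π
  nondegenerate : IsNondegenerateRep π
  selfAdjoint : IsSelfAdjoint D
  dense : Dense (𝒜 : Set A)
  bounded_commutator : ∀ a ∈ 𝒜, ∃ T, CommutatorExtendsTo D (π a) T
  locally_compact : IsLocallyCompactOn 𝒜 π D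

/-! ### Protoral systems and Morita-compatible Dirac structures -/

/-- A protoral inductive system `B_0 → B_1 → ⋯`: `B_n = M_{r_n}(A_{Θ_n})` with `r_n ≥ 1`,
`Θ_n` a nondegenerate skew-symmetric real matrix of size `d_n ≥ 2`, and nonzero
`*`-homomorphisms `φ_n : B_n → B_{n+1}`. -/
structure ProtoralSystem where
  d : ℕ → ℕ
  two_le_d : ∀ n, 2 ≤ d n
  r : ℕ → ℕ
  one_le_r : ∀ n, 1 ≤ r n
  Θ : ∀ n, Matrix (Fin (d n)) (Fin (d n)) ℝ
  skew : ∀ n, (Θ n).transpose = -Θ n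
  nondegenerate : ∀ n, IsNondegenerate (Θ n)
  φ : ∀ n, MatTorus (r n) (Θ n) →⋆ₙₐ[ℂ] MatTorus (r (n + 1)) (Θ (n + 1))
  φ_ne_zero : ∀ n, φ n ≠ 0

namespace ProtoralSystem

variable (X : ProtoralSystem)

/-- The `C*`-algebra `B_n = M_{r_n}(A_{Θ_n})`. -/
abbrev B (n : ℕ) : Type := MatTorus (X.r n) (X.Θ n)

/-- The normalized trace on `B_n`. -/
abbrev τ (n : ℕ) : X.B n →ₚ[ℂ] ℂ := MatTorus.trace

/-- The protorus `A_pro = lim (B_n, φ_n)`. -/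
abbrev Apro : Type := CStarLimit X.φ

/-- The canonical map `ι_n : B_n → A_pro`. -/
abbrev ι (n : ℕ) : X.B n →⋆ₙₐ[ℂ] X.Apro := CStarLimit.of X.φ n

/-- The projection `e_n = ι_n(1)`. -/
def e (n : ℕ) : X.Apro := X.ι n 1

/-- The connecting map `φ_{n,m} : B_n → B_m` for `n ≤ m`. -/
abbrev φTo {n m : ℕ} (h : n ≤ m) : X.B n →⋆ₙₐ[ℂ] X.B m := homTo X.φ h

/-- A `*`-subalgebra `𝒜` of `A_pro` that is dense, whose elements are all supported in some finite
stage (`a = e_n a e_n` for some `n`), and that contains every `e_n`. -/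
structure IsFinitelySupported (𝒜 : NonUnitalStarSubalgebra ℂ X.Apro) : Prop where
  dense : Dense (𝒜 : Set X.Apro)
  supported : ∀ a ∈ 𝒜, ∃ n, a = X.e n * a * X.e n
  e_mem : ∀ n, X.e n ∈ 𝒜

end ProtoralSystem

/-- A smooth factorization `φ_n = ι_{p_n} ∘ α_n ∘ ψ_n` of the connecting maps, where
`ψ_n = Id ⊗ φ_{M,z} : B_n → C_n = M_{r_n}(A_{Ψ_n})` is a unital toric map (the identity is the toric
map with `M = 1` and `z = 1`), `p_n ∈ B_{n+1}^∞` is a full projection, and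
`α_n : C_n ≅ p_n B_{n+1} p_n` restricts to a Fréchet `*`-isomorphism of the smooth subalgebras. -/
structure SmoothFactorization (X : ProtoralSystem) where
  dC : ℕ → ℕ
  Ψ : ∀ n, Matrix (Fin (dC n)) (Fin (dC n)) ℝ
  skew : ∀ n, (Ψ n).transpose = -Ψ n
  ψ : ∀ n, NCTorus (X.Θ n) →⋆ₐ[ℂ] NCTorus (Ψ n)
  toric : ∀ n, IsToric (ψ n)
  p : ∀ n, X.B (n + 1)
  isStarProjection : ∀ n, IsStarProjection (p n)
  smooth_p : ∀ n, (p n).IsSmooth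
  full_p : ∀ n, IsFull (p n)
  α : ∀ n, MatTorus (X.r n) (Ψ n) ≃⋆ₐ[ℂ] Corner (p n) (isStarProjection n)
  image_smooth : ∀ n,
    (fun c => Corner.incl (p n) (isStarProjection n) (α n c)) '' {c | c.IsSmooth} =
      {x | ∃ b : X.B (n + 1), b.IsSmooth ∧ x = p n * b * p n}
  continuous_α : ∀ n k, ∃ (l : ℕ) (C : ℝ), ∀ c : MatTorus (X.r n) (Ψ n), c.IsSmooth →
    (Corner.incl (p n) (isStarProjection n) (α n c)).smoothSeminorm k ≤ C * ∑ i ∈ Finset.range l,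
      c.smoothSeminorm i
  continuous_α_symm : ∀ n k, ∃ (l : ℕ) (C : ℝ), ∀ c : MatTorus (X.r n) (Ψ n), c.IsSmooth →
    c.smoothSeminorm k ≤ C * ∑ i ∈ Finset.range l,
      (Corner.incl (p n) (isStarProjection n) (α n c)).smoothSeminorm i
  factor : ∀ n b, X.φ n b =
    Corner.incl (p n) (isStarProjection n) (α n (MatTorus.amplify (X.r n) (ψ n) b))

namespace SmoothFactorization

variable {X : ProtoralSystem} (F : SmoothFactorization X)

/-- The intermediate matrix-amplified torus `C_n = M_{r_n}(A_{Ψ_n})`. -/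
abbrev C (n : ℕ) : Type := MatTorus (X.r n) (F.Ψ n)

/-- The normalized trace `ω_n` on `C_n`. -/
abbrev ω (n : ℕ) : F.C n →ₚ[ℂ] ℂ := MatTorus.trace

/-- The corner `p_n B_{n+1} p_n`. -/
abbrev corner (n : ℕ) : Type := Corner (F.p n) (F.isStarProjection n)

/-- The normalized trace `τ_{p_n} = τ_{n+1} / τ_{n+1}(p_n)` on the corner. -/
abbrev τp (n : ℕ) : F.corner n →ₚ[ℂ] ℂ := Corner.trace (F.p n) (F.isStarProjection n) (X.τ (n + 1))

/-- The corner inclusion `ι_{p_n}`. -/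
abbrev incl (n : ℕ) : F.corner n →⋆ₙₐ[ℂ] X.B (n + 1) := Corner.incl (F.p n) (F.isStarProjection n)

/-- The amplified toric map `ψ_n : B_n → C_n`. -/
abbrev toricMap (n : ℕ) (b : X.B n) : F.C n := MatTorus.amplify (X.r n) (F.ψ n) b

end SmoothFactorization

/-- A Morita-compatible Dirac structure on a protoral system. -/
structure MoritaDirac (X : ProtoralSystem) extends SmoothFactorization X where
  /-- The spinor spaces `S_n`, `S_n^C` and `S_{n+1}^{(p_n)}`. -/
  S : ℕ → Type
  SC : ℕ → Type
  Sp : ℕ → Type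
  [normedS : ∀ n, NormedAddCommGroup (S n)]
  [innerS : ∀ n, InnerProductSpace ℂ (S n)]
  [finiteS : ∀ n, FiniteDimensional ℂ (S n)]
  /-- `S_n ≠ 0`, so that the representation of `B_n` on `L²(B_n, τ_n) ⊗ S_n` is faithful. -/
  nontrivial_S : ∀ n, Nontrivial (S n)
  [normedSC : ∀ n, NormedAddCommGroup (SC n)]
  [innerSC : ∀ n, InnerProductSpace ℂ (SC n)]
  [finiteSC : ∀ n, FiniteDimensional ℂ (SC n)]
  [normedSp : ∀ n, NormedAddCommGroup (Sp n)]
  [innerSp : ∀ n, InnerProductSpace ℂ (Sp n)]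
  [finiteSp : ∀ n, FiniteDimensional ℂ (Sp n)]
  /-- The selfadjoint operators `D_n`, `D_n^C` and `D_{n+1}^{(p_n)}`. -/
  D : ∀ n, L2Tensor (X.τ n) (S n) →ₗ.[ℂ] L2Tensor (X.τ n) (S n)
  DC : ∀ n, L2Tensor (toSmoothFactorization.ω n) (SC n) →ₗ.[ℂ]
    L2Tensor (toSmoothFactorization.ω n) (SC n)
  Dp : ∀ n, L2Tensor (toSmoothFactorization.τp n) (Sp n) →ₗ.[ℂ]
    L2Tensor (toSmoothFactorization.τp n) (Sp n)
  selfAdjoint_D : ∀ n, IsSelfAdjoint (D n)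
  selfAdjoint_DC : ∀ n, IsSelfAdjoint (DC n)
  selfAdjoint_Dp : ∀ n, IsSelfAdjoint (Dp n)
  /-- The isometries `I_{ψ_n}`, `I_{α_n}` and `I_{ι_{p_n}}`. -/
  Iψ : ∀ n, L2Tensor (X.τ n) (S n) →ₗᵢ[ℂ] L2Tensor (toSmoothFactorization.ω n) (SC n)
  Iα : ∀ n, L2Tensor (toSmoothFactorization.ω n) (SC n) →ₗᵢ[ℂ]
    L2Tensor (toSmoothFactorization.τp n) (Sp n)
  Iι : ∀ n, L2Tensor (toSmoothFactorization.τp n) (Sp n) →ₗᵢ[ℂ]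
    L2Tensor (X.τ (n + 1)) (S (n + 1))
  intertwines_ψ : ∀ n, Intertwines (Iψ n) (D n) (DC n)
  intertwines_α : ∀ n, Intertwines (Iα n) (DC n) (Dp n)
  intertwines_ι : ∀ n, Intertwines (Iι n) (Dp n) (D (n + 1))
  rep_ψ : ∀ n (b : X.B n) η, Iψ n (L2Tensor.leftMul (X.τ n) b η) =
    L2Tensor.leftMul (toSmoothFactorization.ω n) (toSmoothFactorization.toricMap n b) (Iψ n η)
  rep_α : ∀ n (c : toSmoothFactorization.C n) η,
    Iα n (L2Tensor.leftMul (toSmoothFactorization.ω n) c η) =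
      L2Tensor.leftMul (toSmoothFactorization.τp n) (α n c) (Iα n η)
  rep_ι : ∀ n (x : toSmoothFactorization.corner n) η,
    Iι n (L2Tensor.leftMul (toSmoothFactorization.τp n) x η) =
      L2Tensor.leftMul (X.τ (n + 1)) (toSmoothFactorization.incl n x) (Iι n η)
  /-- The spinor isometries `J_n`. -/
  J : ∀ n, S n →ₗᵢ[ℂ] S (n + 1)
  /-- The composite is the trace-rescaled GNS isometry
  `Λ_n(a) ⊗ ξ ↦ t_n^{-1/2} Λ_{n+1}(φ_n(a)) ⊗ J_n ξ`, with `t_n = τ_{n+1}(φ_n(1))`. -/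
  rescaled : ∀ n (a : X.B n) (ξ : S n), Iι n (Iα n (Iψ n (L2Tensor.vec (X.τ n) a ξ))) =
    ((√(X.τ (n + 1) (X.φ n 1)).re)⁻¹ : ℂ) • L2Tensor.vec (X.τ (n + 1)) (X.φ n a) (J n ξ)

namespace MoritaDirac

attribute [instance] MoritaDirac.normedS MoritaDirac.innerS MoritaDirac.finiteS
  MoritaDirac.normedSC MoritaDirac.innerSC MoritaDirac.finiteSC
  MoritaDirac.normedSp MoritaDirac.innerSp MoritaDirac.finiteSp

variable {X : ProtoralSystem} (M : MoritaDirac X)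

/-- The Hilbert space `H_n = L²(B_n, τ_n) ⊗ S_n`. -/
abbrev H (n : ℕ) : Type := L2Tensor (X.τ n) (M.S n)

/-- The representation `π_n` of `B_n` on `H_n` by left multiplication. -/
abbrev rep (n : ℕ) (b : X.B n) : M.H n →L[ℂ] M.H n := L2Tensor.leftMul (X.τ n) b

/-- The isometry `I_n = I_{ι_{p_n}} ∘ I_{α_n} ∘ I_{ψ_n} : H_n → H_{n+1}`. -/
def I (n : ℕ) : M.H n →ₗᵢ[ℂ] M.H (n + 1) := (M.Iι n).comp ((M.Iα n).comp (M.Iψ n))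

/-- The isometry `I_{m,k} : H_m → H_k` for `m ≤ k`. -/
abbrev ITo {m k : ℕ} (h : m ≤ k) : M.H m →ₗᵢ[ℂ] M.H k := isometryTo (E := M.H) M.I h

/-- The Hilbert space `H_pro = lim (H_n, I_n)`. -/
abbrev Hpro : Type := HilbertLimit (E := M.H) M.I

/-- The canonical isometry `I_{n,∞} : H_n → H_pro`. -/
abbrev Iinf (n : ℕ) : M.H n →ₗᵢ[ℂ] M.Hpro := toHilbertLimit (E := M.H) M.I n

/-- The operator `D_0` with domain `⋃ I_{n,∞}(dom D_n)` and `D_0 I_{n,∞} ξ = I_{n,∞} D_n ξ`; its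
graph is the increasing union of the images of the graphs of the `D_n`. -/
def D₀ : M.Hpro →ₗ.[ℂ] M.Hpro :=
  (⨆ n, (M.D n).graph.map
    ((M.Iinf n).toLinearMap.prodMap (M.Iinf n).toLinearMap)).toLinearPMap

/-- The operator `D_pro`, the closure of `D_0`. -/
def Dpro : M.Hpro →ₗ.[ℂ] M.Hpro := M.D₀.closure

/-- `π` is the limit representation of `A_pro` on `H_pro`:
`π(ι_n(b)) I_{m,∞} η = I_{k,∞} π_k(φ_{n,k}(b)) I_{m,k} η` for `k ≥ n, m`. As the `ι_n(B_n)` and the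
`I_{m,∞} H_m` have dense union, this determines `π`. -/
def IsLimitRep (π : X.Apro →⋆ₙₐ[ℂ] (M.Hpro →L[ℂ] M.Hpro)) : Prop :=
  ∀ (n m k : ℕ) (hn : n ≤ k) (hm : m ≤ k) (b : X.B n) (η : M.H m),
    π (X.ι n b) (M.Iinf m η) = M.Iinf k (M.rep k (X.φTo hn b) (M.ITo hm η))

/-- The stagewise commutators `[D_m, π_m(φ_{n,m}(a))]`, `m ≥ n`, extend to bounded operators, with
uniformly bounded norms. -/
def StagewiseBounded {n : ℕ} (a : X.B n) : Prop :=
  ∃ C : ℝ, ∀ (m : ℕ) (h : n ≤ m), ∃ T : M.H m →L[ℂ] M.H m,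
    CommutatorExtendsTo (M.D m) (M.rep m (X.φTo h a)) T ∧ ‖T‖ ≤ C

end MoritaDirac

end Protorus

end

noncomputable section

namespace Protorus

open scoped ComplexOrder TensorProduct InnerProductSpace
open Filter Topology

/-! ### Operators on inductive limits of Hilbert spaces -/

section HilbertLimit

variable {E : ℕ → Type*} [∀ n, NormedAddCommGroup (E n)] [∀ n, InnerProductSpace ℂ (E n)]
  (V : ∀ n, E n →ₗᵢ[ℂ] E (n + 1))

/-! Everything rests on a rigidity of selfadjoint operators. If an isometry `V` intertwines
selfadjoint `D` and `D'`, then `V^* D' V` restricted to vectors carried by `V` into `dom D'` extends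
`D`, and selfadjointness of `D` leaves no room for a proper extension: the part of `D'` over the
range of `V` is exactly the image of `D` (`Intertwines.exists_of_mem_graph`). The Dirac structure
enters through `I_rep` and `intertwines_I`: the composite isometries intertwine the representations
and the operators `D_n`.

Selfadjointness of `D_pro`. The graphs of the `D_n` form an increasing union in the limit, which is
symmetric and densely defined, hence closable. A pair in the graph of the adjoint, compressed to
stage `n`, satisfies the adjoint relation of `D_n` and so lies in the graph of `D_n`; the stage
projections tend strongly to the identity, so the pair lies in the closure
(`isSelfAdjoint_limitOperator`).

The representation. Stage operators that commute with the isometries and are uniformly bounded glue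
to an operator on the limit (`exists_limit_operator`). This turns the `π_n` into compatible
representations of the `B_n` on `H_pro`, and the universal property of the C*-limit gives `π`. It is
faithful because every stage representation is injective, hence isometric. Injectivity comes down to
faithfulness of the trace of `A_Θ`: `τ(a^* a) = ‖a δ_0‖²`, and `a` commutes with the right
translations, which carry `δ_0` to every basis vector.

Commutators. A bounded commutator on `H_pro` compresses to each stage without increase of norm.
Conversely the stagewise commutators are automatically compatible, and a uniform bound lets them
glue; the commutator relation, phrased on graphs, survives the closure (`exists_commutator_iff`).

Local compactness. If `a = e_n a e_n`, then `π(a)(1+D²)^{-1/2}` is a bounded operator times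
`π(e_n)(1+D²)^{-1/2}`; conversely the `e_n` belong to the algebra. -/

theorem isometryTo_trans {n k l : ℕ} (h : n ≤ k) (h' : k ≤ l) (x : E n) :
    isometryTo V h' (isometryTo V h x) = isometryTo V (h.trans h') x := by
  induction l, h' using Nat.le_induction with
  | base => rw [isometryTo_self]
  | succ l hl ih => rw [isometryTo_succ V hl, ih, isometryTo_succ V (h.trans hl)]

namespace PreHilbertLimit

variable {V}

theorem eventually_norm (f : PreHilbertLimit V) : ∀ᶠ n in atTop, ‖seq f n‖ = ‖f‖ := by
  filter_upwards [eventually_inner f f] with n hn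
  have h : ⟪seq f n, seq f n⟫_ℂ = ⟪f, f⟫_ℂ := hn
  rw [inner_self_eq_norm_sq_to_K, inner_self_eq_norm_sq_to_K] at h
  have h2 : ‖seq f n‖ ^ 2 = ‖f‖ ^ 2 := by exact_mod_cast h
  exact (sq_eq_sq₀ (norm_nonneg _) (norm_nonneg _)).1 h2

theorem seq_toPreHilbertLimit {n k : ℕ} (h : n ≤ k) (x : E n) :
    seq (toPreHilbertLimit V n x) k = isometryTo V h x := dif_pos h

theorem seq_succ (f : PreHilbertLimit V) : ∀ᶠ n in atTop, seq f (n + 1) = V n (seq f n) := f.2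

theorem norm_sub_eq_zero_of_eventually {f g : PreHilbertLimit V}
    (h : ∀ᶠ n in atTop, seq f n = seq g n) : ‖f - g‖ = 0 := by
  obtain ⟨n, h1, h2⟩ := ((eventually_norm (f - g)).and h).exists
  rw [← h1, map_sub, Pi.sub_apply, h2, sub_self, norm_zero]

end PreHilbertLimit

open PreHilbertLimit

/-- The algebraic limit carries only a seminorm; sequences that agree eventually are at distance
zero and are identified in the completion. Identities between stage vectors below are checked on
late terms through this. -/
theorem ofPreHilbertLimit_eq_of_eventually {f g : PreHilbertLimit V}
    (h : ∀ᶠ n in atTop, seq f n = seq g n) : ofPreHilbertLimit V f = ofPreHilbertLimit V g := by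
  rw [← sub_eq_zero, ← map_sub, ← norm_eq_zero, LinearIsometry.norm_map]
  exact norm_sub_eq_zero_of_eventually h

theorem toHilbertLimit_apply (n : ℕ) (x : E n) :
    toHilbertLimit V n x = ofPreHilbertLimit V (toPreHilbertLimit V n x) := rfl

theorem toHilbertLimit_isometryTo {n k : ℕ} (h : n ≤ k) (x : E n) :
    toHilbertLimit V k (isometryTo V h x) = toHilbertLimit V n x := by
  rw [toHilbertLimit_apply, toHilbertLimit_apply]
  apply ofPreHilbertLimit_eq_of_eventually
  filter_upwards [eventually_ge_atTop k] with l hl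
  rw [seq_toPreHilbertLimit hl, seq_toPreHilbertLimit (h.trans hl), isometryTo_trans]

theorem isometryTo_self_succ (n : ℕ) (x : E n) : isometryTo V n.le_succ x = V n x := by
  rw [isometryTo_succ V le_rfl, isometryTo_self]

theorem toHilbertLimit_succ (n : ℕ) (x : E n) :
    toHilbertLimit V (n + 1) (V n x) = toHilbertLimit V n x := by
  rw [← isometryTo_self_succ, toHilbertLimit_isometryTo]

/-- A compatible sequence agrees, from the point where compatibility starts, with the sequence
issued from its own term there. The bound `n₀` allows arguments that work only from some stage on.
-/
theorem exists_toHilbertLimit_eq (f : PreHilbertLimit V) (n₀ : ℕ) :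
    ∃ n ≥ n₀, ∃ x : E n, toHilbertLimit V n x = ofPreHilbertLimit V f := by
  obtain ⟨N, hN⟩ := eventually_atTop.1 (seq_succ f)
  refine ⟨max N n₀, le_max_right _ _, seq f (max N n₀), ?_⟩
  rw [toHilbertLimit_apply]
  apply ofPreHilbertLimit_eq_of_eventually
  filter_upwards [eventually_ge_atTop (max N n₀)] with l hl
  rw [seq_toPreHilbertLimit hl]
  induction l, hl using Nat.le_induction with
  | base => rw [isometryTo_self]
  | succ l hl ih => rw [isometryTo_succ V hl, ih, hN l ((le_max_left _ _).trans hl)]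

theorem denseRange_ofPreHilbertLimit : DenseRange (ofPreHilbertLimit V) :=
  UniformSpace.Completion.denseRange_coe

/-- The vectors coming from the stages `n ≥ n₀` are dense in the limit. -/
theorem dense_toHilbertLimit (n₀ : ℕ) :
    Dense {y : HilbertLimit V | ∃ n ≥ n₀, ∃ x : E n, toHilbertLimit V n x = y} := by
  refine (denseRange_ofPreHilbertLimit V).mono ?_
  rintro _ ⟨f, rfl⟩
  exact exists_toHilbertLimit_eq V f n₀

variable {V} in
theorem HilbertLimit.clm_ext {F : Type*} [NormedAddCommGroup F] [NormedSpace ℂ F] (n₀ : ℕ)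
    {T S : HilbertLimit V →L[ℂ] F}
    (h : ∀ n ≥ n₀, ∀ x : E n, T (toHilbertLimit V n x) = S (toHilbertLimit V n x)) : T = S := by
  refine ContinuousLinearMap.coeFn_injective
    (Continuous.ext_on (dense_toHilbertLimit V n₀) T.continuous S.continuous ?_)
  rintro _ ⟨n, hn, x, rfl⟩
  exact h n hn x

-- Two stage vectors can be moved to a common later stage, so a closed relation needs checking only
-- on pairs from one stage. It serves to verify adjoint relations.
variable {V} in
theorem HilbertLimit.induction_pair (n₀ : ℕ) {P : HilbertLimit V → HilbertLimit V → Prop}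
    (hP : IsClosed {q : HilbertLimit V × HilbertLimit V | P q.1 q.2})
    (h : ∀ n ≥ n₀, ∀ x y : E n, P (toHilbertLimit V n x) (toHilbertLimit V n y))
    (x y : HilbertLimit V) : P x y := by
  have hd := (dense_toHilbertLimit V n₀).prod (dense_toHilbertLimit V n₀)
  have : (x, y) ∈ {q : HilbertLimit V × HilbertLimit V | P q.1 q.2} := by
    rw [← hP.closure_eq]
    refine closure_mono ?_ (hd (x, y))
    rintro ⟨_, _⟩ ⟨⟨n, hn, u, rfl⟩, ⟨m, hm, v, rfl⟩⟩
    have h1 := h (max n m) (hn.le.trans (le_max_left n m))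
      (isometryTo V (le_max_left n m) u) (isometryTo V (le_max_right n m) v)
    rwa [toHilbertLimit_isometryTo, toHilbertLimit_isometryTo] at h1
  exact this

/-- A uniformly bounded sequence of operators that is compatible with the isometries from stage
`n₀` on induces an operator on the limit. -/
theorem exists_limit_operator (n₀ : ℕ) (T : ∀ n, E n →L[ℂ] E n) (C : ℝ) (hC : ∀ n, ‖T n‖ ≤ C)
    (hT : ∀ n ≥ n₀, ∀ x, T (n + 1) (V n x) = V n (T n x)) :
    ∃ S : HilbertLimit V →L[ℂ] HilbertLimit V,
      ∀ n ≥ n₀, ∀ x, S (toHilbertLimit V n x) = toHilbertLimit V n (T n x) := by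
  -- The operators act term by term; compatibility from `n₀` on is enough because membership in the
  -- algebraic limit is an eventual condition.
  let S₀ : PreHilbertLimit V →ₗ[ℂ] PreHilbertLimit V :=
    { toFun := fun f => ⟨fun n => T n (seq f n), by
        filter_upwards [seq_succ f, eventually_ge_atTop n₀] with n h1 h2
        rw [h1, hT n h2]⟩
      map_add' := fun f g => Subtype.ext <| funext fun n => (T n).map_add (seq f n) (seq g n)
      map_smul' := fun c f => Subtype.ext <| funext fun n => (T n).map_smul c (seq f n) }
  have hS₀ : ∀ f n, seq (S₀ f) n = T n (seq f n) := fun _ _ => rfl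
  -- Both seminorms are attained at one late stage, where the bound on `T n` applies.
  have hb : ∀ f, ‖S₀ f‖ ≤ C * ‖f‖ := by
    intro f
    obtain ⟨n, h1, h2⟩ := ((eventually_norm f).and (eventually_norm (S₀ f))).exists
    rw [← h1, ← h2, hS₀]
    exact (T n).le_of_opNorm_le (hC n) _
  let S₁ := S₀.mkContinuous C hb
  refine ⟨(S₁.completion : UniformSpace.Completion (PreHilbertLimit V) →L[ℂ]
    UniformSpace.Completion (PreHilbertLimit V)), fun n hn x => ?_⟩
  have h1 : ∀ f, (S₁.completion : UniformSpace.Completion (PreHilbertLimit V) →L[ℂ]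
      UniformSpace.Completion (PreHilbertLimit V)) (ofPreHilbertLimit V f) =
        ofPreHilbertLimit V (S₀ f) := fun f =>
    UniformSpace.Completion.map_coe (ContinuousLinearMap.uniformContinuous _) _
  rw [toHilbertLimit_apply]
  refine (h1 _).trans ?_
  rw [toHilbertLimit_apply]
  apply ofPreHilbertLimit_eq_of_eventually
  filter_upwards [eventually_ge_atTop n] with k hk
  rw [hS₀, seq_toPreHilbertLimit hk, seq_toPreHilbertLimit hk]
  induction k, hk using Nat.le_induction with
  | base => rw [isometryTo_self, isometryTo_self]
  | succ k hk ih =>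
    rw [isometryTo_succ V hk, isometryTo_succ V hk, hT k (hn.le.trans hk), ih]

/-! ### Orthogonal projections onto the stages -/

section Projection

variable [∀ n, CompleteSpace (E n)]

/-- The orthogonal projection `V_{n,∞} V_{n,∞}^*` onto the `n`-th stage. -/
def stageProj (n : ℕ) : HilbertLimit V →L[ℂ] HilbertLimit V :=
  (toHilbertLimit V n).toContinuousLinearMap ∘L
    (toHilbertLimit V n).toContinuousLinearMap.adjoint

theorem _root_.LinearIsometry.adjoint_apply_self {E F : Type*} [NormedAddCommGroup E]
    [InnerProductSpace ℂ E] [NormedAddCommGroup F] [InnerProductSpace ℂ F] [CompleteSpace E]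
    [CompleteSpace F] (W : E →ₗᵢ[ℂ] F) (x : E) :
    W.toContinuousLinearMap.adjoint (W x) = x := by
  refine ext_inner_right ℂ fun y => ?_
  rw [ContinuousLinearMap.adjoint_inner_left]
  exact W.inner_map_map x y

theorem _root_.LinearIsometry.norm_toContinuousLinearMap_adjoint_le {E F : Type*}
    [NormedAddCommGroup E]
    [InnerProductSpace ℂ E] [NormedAddCommGroup F] [InnerProductSpace ℂ F] [CompleteSpace E]
    [CompleteSpace F] (W : E →ₗᵢ[ℂ] F) : ‖W.toContinuousLinearMap.adjoint‖ ≤ 1 := by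
  rw [LinearIsometryEquiv.norm_map]
  exact W.norm_toContinuousLinearMap_le

theorem norm_stageProj_le (n : ℕ) (x : HilbertLimit V) : ‖stageProj V n x‖ ≤ ‖x‖ := by
  have h : ‖stageProj V n x‖ = ‖(toHilbertLimit V n).toContinuousLinearMap.adjoint x‖ :=
    (toHilbertLimit V n).norm_map _
  rw [h]
  simpa using ContinuousLinearMap.le_of_opNorm_le _
    (toHilbertLimit V n).norm_toContinuousLinearMap_adjoint_le x

theorem stageProj_toHilbertLimit {n k : ℕ} (h : n ≤ k) (x : E n) :
    stageProj V k (toHilbertLimit V n x) = toHilbertLimit V n x := by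
  rw [← toHilbertLimit_isometryTo V h]
  exact congrArg (toHilbertLimit V k) ((toHilbertLimit V k).adjoint_apply_self _)

/-- The stage projections converge strongly to the identity. -/
theorem tendsto_stageProj (x : HilbertLimit V) :
    Tendsto (fun n => stageProj V n x) atTop (𝓝 x) := by
  rw [Metric.tendsto_atTop]
  intro ε hε
  -- An approximant from stage `n` is fixed by all projections with index `k ≥ n`; contractivity
  -- handles the remainder, whence two halves of `ε`.
  obtain ⟨_, ⟨n, -, y, rfl⟩, hy⟩ := (dense_toHilbertLimit V 0).exists_dist_lt x (half_pos hε)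
  refine ⟨n, fun k hk => ?_⟩
  have h1 := norm_stageProj_le V k (x - toHilbertLimit V n y)
  rw [map_sub, stageProj_toHilbertLimit V hk] at h1
  rw [dist_eq_norm] at hy ⊢
  have h2 := norm_sub_le_norm_sub_add_norm_sub (stageProj V k x) (toHilbertLimit V n y) x
  rw [norm_sub_rev (toHilbertLimit V n y)] at h2
  linarith

end Projection

end HilbertLimit

/-! ### The universal property of inductive limits of `C*`-algebras -/

section CStarLimit

variable {B : ℕ → Type*} [∀ n, NonUnitalCStarAlgebra (B n)] {φ : ∀ n, B n →⋆ₙₐ[ℂ] B (n + 1)}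
  {A : Type*} [NonUnitalCStarAlgebra A] {ρ : ∀ n, B n →⋆ₙₐ[ℂ] A}

theorem compatible_homTo (hρ : ∀ n b, ρ (n + 1) (φ n b) = ρ n b) {n k : ℕ} (h : n ≤ k) (b : B n) :
    ρ k (homTo φ h b) = ρ n b := by
  induction k, h using Nat.le_induction with
  | base => rw [homTo_self]
  | succ k hk ih => rw [homTo_succ φ hk, hρ, ih]

/-- By compatibility `ρ_N(f_N)` equals `ρ_n(φ_{N,n}(f_N))`, so contractivity of `ρ_n` bounds its
distance to `ρ_n(f_n)` by `‖f_n - φ_{N,n}(f_N)‖`. -/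
theorem AsymptoticSeq.cauchySeq_compatible (hρ : ∀ n b, ρ (n + 1) (φ n b) = ρ n b)
    (f : AsymptoticSeq φ) : CauchySeq fun n => ρ n (seq f n) := by
  rw [Metric.cauchySeq_iff']
  intro ε hε
  obtain ⟨N, hN⟩ := isAsymptotic_seq f (ε / 2) (half_pos hε)
  refine ⟨N, fun n hn => ?_⟩
  rw [dist_eq_norm, ← compatible_homTo hρ hn (seq f N), ← map_sub]
  exact ((NonUnitalStarAlgHom.norm_apply_le _ _).trans (hN N le_rfl n hn)).trans_lt
    (half_lt_self hε)

/-- Compatible `*`-homomorphisms `ρ_n : B_n → A` induce a `*`-homomorphism on the limit. -/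
theorem CStarLimit.exists_lift (hρ : ∀ n b, ρ (n + 1) (φ n b) = ρ n b) :
    ∃ π : CStarLimit φ →⋆ₙₐ[ℂ] A, ∀ f : AsymptoticSeq φ,
      Tendsto (fun n => ρ n (AsymptoticSeq.seq f n)) atTop (𝓝 (π (mk f))) := by
  choose p hp using fun f : AsymptoticSeq φ =>
    cauchySeq_tendsto_of_complete (AsymptoticSeq.cauchySeq_compatible hρ f)
  -- The limit map is contractive for the seminorm, which makes it descend to the separation
  -- quotient.
  have hnorm : ∀ f g, ‖p f - p g‖ ≤ ‖f - g‖ := fun f g =>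
    le_of_tendsto_of_tendsto' ((hp f).sub (hp g)).norm (AsymptoticSeq.tendsto_norm (f - g))
      fun n => by
        rw [← map_sub, AsymptoticSeq.seq_sub]
        exact NonUnitalStarAlgHom.norm_apply_le _ _
  let q : CStarLimit φ → A := SeparationQuotient.lift p fun f g h => by
    rw [Metric.inseparable_iff, dist_eq_norm] at h
    exact sub_eq_zero.1 (norm_le_zero_iff.1 ((hnorm f g).trans h.le))
  have hq : ∀ f, q (mk f) = p f := fun f => rfl
  -- Each algebraic identity is then an identity of termwise limits, by uniqueness of limits.
  have hlim : ∀ (f : AsymptoticSeq φ) {a : A},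
      Tendsto (fun n => ρ n (AsymptoticSeq.seq f n)) atTop (𝓝 a) → q (mk f) = a :=
    fun f _ ha => tendsto_nhds_unique (hp f) ha
  refine ⟨{ toFun := q, map_smul' := ?_, map_zero' := ?_, map_add' := ?_, map_mul' := ?_,
            map_star' := ?_ }, hp⟩
  · intro c x
    obtain ⟨f, rfl⟩ := mk_surjective x
    exact hlim (c • f) (((hp f).const_smul c).congr fun n => (map_smul (ρ n) c _).symm)
  · exact hlim 0 (tendsto_const_nhds.congr fun n => (map_zero (ρ n)).symm)
  · intro x y
    obtain ⟨f, rfl⟩ := mk_surjective x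
    obtain ⟨g, rfl⟩ := mk_surjective y
    exact hlim (f + g) (((hp f).add (hp g)).congr fun n => (map_add (ρ n) _ _).symm)
  · intro x y
    obtain ⟨f, rfl⟩ := mk_surjective x
    obtain ⟨g, rfl⟩ := mk_surjective y
    exact hlim (f * g) (((hp f).mul (hp g)).congr fun n => (map_mul (ρ n) _ _).symm)
  · intro x
    obtain ⟨f, rfl⟩ := mk_surjective x
    exact hlim (star f) ((hp f).star.congr fun n => (map_star (ρ n) _).symm)

theorem CStarLimit.lift_of (hρ : ∀ n b, ρ (n + 1) (φ n b) = ρ n b)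
    {π : CStarLimit φ →⋆ₙₐ[ℂ] A} (hπ : ∀ f : AsymptoticSeq φ,
      Tendsto (fun n => ρ n (AsymptoticSeq.seq f n)) atTop (𝓝 (π (mk f)))) (n : ℕ) (b : B n) :
    π (of φ n b) = ρ n b := by
  refine tendsto_nhds_unique (hπ _) (tendsto_const_nhds.congr' ?_)
  filter_upwards [eventually_ge_atTop n] with k hk
  change ρ n b = ρ k (if h : n ≤ k then homTo φ h b else 0)
  rw [dif_pos hk, compatible_homTo hρ]

/-- Injective `*`-homomorphisms are isometric, so `‖π(x)‖ = lim ‖ρ_n(f_n)‖ = lim ‖f_n‖ = ‖x‖`. -/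
theorem CStarLimit.lift_injective (hinj : ∀ n, Function.Injective (ρ n))
    {π : CStarLimit φ →⋆ₙₐ[ℂ] A} (hπ : ∀ f : AsymptoticSeq φ,
      Tendsto (fun n => ρ n (AsymptoticSeq.seq f n)) atTop (𝓝 (π (mk f)))) :
    Function.Injective π := by
  rw [injective_iff_map_eq_zero]
  intro x hx
  obtain ⟨f, rfl⟩ := mk_surjective x
  rw [← norm_eq_zero, norm_mk]
  have h := (hπ f).norm
  rw [hx, norm_zero] at h
  exact tendsto_nhds_unique (AsymptoticSeq.tendsto_norm f)
    (h.congr fun n => NonUnitalStarAlgHom.norm_map (ρ n) (hinj n) _)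

end CStarLimit

/-! ### Faithfulness of the traces -/

section RightTranslation

variable {m : ℕ} (Θ : Matrix (Fin m) (Fin m) ℝ)

/-- The exponent is biadditive, so the cocycle is a bicharacter. -/
theorem cocycle_add_left (x y z : Fin m → ℤ) :
    cocycle Θ (x + y) z = cocycle Θ x z * cocycle Θ y z := by
  unfold cocycle
  rw [← Complex.exp_add, ← add_mul, ← Complex.ofReal_add, ← mul_add, ← Finset.sum_add_distrib]
  congr 4
  refine Finset.sum_congr rfl fun (j : Fin m) _ => ?_
  rw [← Finset.sum_add_distrib]
  refine Finset.sum_congr rfl fun (k : Fin m) _ => ?_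
  split_ifs
  · simp only [Pi.add_apply, Int.cast_add]
    ring
  · simp

theorem cocycle_add_right (x y z : Fin m → ℤ) :
    cocycle Θ x (y + z) = cocycle Θ x y * cocycle Θ x z := by
  unfold cocycle
  rw [← Complex.exp_add, ← add_mul, ← Complex.ofReal_add, ← mul_add, ← Finset.sum_add_distrib]
  congr 4
  refine Finset.sum_congr rfl fun (j : Fin m) _ => ?_
  rw [← Finset.sum_add_distrib]
  refine Finset.sum_congr rfl fun (k : Fin m) _ => ?_
  split_ifs
  · simp only [Pi.add_apply, Int.cast_add]
    ring
  · simp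

theorem cocycle_ne_zero (x y : Fin m → ℤ) : cocycle Θ x y ≠ 0 := Complex.exp_ne_zero _

theorem cocycle_zero_left (x : Fin m → ℤ) : cocycle Θ 0 x = 1 := by simp [cocycle]

/-- The twisted right translation `δ_y ↦ ω_Θ(y, x) δ_{y+x}` on `ℓ²(ℤᵐ)`. -/
def rightTranslation (x : Fin m → ℤ) : L2Z m →ₗᵢ[ℂ] L2Z m where
  toFun f := ⟨fun y => cocycle Θ (y - x) x * f (y - x), by
    refine memℓp_gen ((hasSum_translation Θ x f).summable.congr fun y => ?_)
    simp [norm_cocycle]⟩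
  map_add' f g := by
    ext y
    exact mul_add _ _ _
  map_smul' c f := by
    ext y
    simp only [lp.coeFn_smul, Pi.smul_apply, smul_eq_mul, RingHom.id_apply]
    ring
  norm_map' f := by
    rw [← (translation Θ x).norm_map f]
    have h2 : (0 : ℝ) < (2 : ENNReal).toReal := by norm_num
    rw [lp.norm_eq_tsum_rpow h2, lp.norm_eq_tsum_rpow h2]
    congr 2
    ext y
    simp [translation_apply, norm_cocycle]

theorem rightTranslation_apply (x : Fin m → ℤ) (f : L2Z m) (y : Fin m → ℤ) :
    rightTranslation Θ x f y = cocycle Θ (y - x) x * f (y - x) := rfl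

/-- Left and right regular representations commute: expanded by the bicharacter property, both sides
carry the phase `ω(x, z-x-y) ω(x, y) ω(z-x-y, y)`. -/
theorem translation_rightTranslation (x y : Fin m → ℤ) (f : L2Z m) :
    translation Θ x (rightTranslation Θ y f) = rightTranslation Θ y (translation Θ x f) := by
  ext z
  have h1 : z - y - x = z - x - y := by abel
  have h2 : z - x = (z - x - y) + y := by abel
  have h3 : z - y = (z - x - y) + x := by abel
  rw [translation_apply, rightTranslation_apply, rightTranslation_apply, translation_apply, h1,
    show cocycle Θ x (z - x) = cocycle Θ x (z - x - y) * cocycle Θ x y by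
      rw [← cocycle_add_right, ← h2],
    show cocycle Θ (z - y) y = cocycle Θ (z - x - y) y * cocycle Θ x y by
      rw [← cocycle_add_left, ← h3]]
  ring

/-- No phase appears since `ω(0, x) = 1`. Thus `δ_0` is cyclic for the right translations, hence
separating for operators that commute with them. -/
theorem rightTranslation_single_zero (x : Fin m → ℤ) :
    rightTranslation Θ x (lp.single 2 0 1) = lp.single 2 x 1 := by
  ext y
  rw [rightTranslation_apply]
  by_cases h : y = x
  · subst h
    simp [cocycle_zero_left]
  · have h' : y - x ≠ 0 := sub_ne_zero.2 h
    simp [h, h']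

theorem translation_zero : (translation Θ 0).toContinuousLinearMap = 1 := by
  ext f y
  simp [translation_apply, cocycle_zero_left]

/-- The adjoint is a left inverse of the isometry `λ_x`, and a multiple of `λ_{-x}` is a right
inverse, so the two coincide. Adjoints of generators are thereby reduced to generators. -/
theorem star_translation (x : Fin m → ℤ) :
    star (translation Θ x).toContinuousLinearMap =
      (cocycle Θ x (-x))⁻¹ • (translation Θ (-x)).toContinuousLinearMap := by
  have h1 : star (translation Θ x).toContinuousLinearMap * (translation Θ x).toContinuousLinearMap
      = 1 := by
    ext1 f
    exact (translation Θ x).adjoint_apply_self f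
  have h2 : (translation Θ x).toContinuousLinearMap *
      ((cocycle Θ x (-x))⁻¹ • (translation Θ (-x)).toContinuousLinearMap) = 1 := by
    rw [mul_smul_comm, inv_smul_eq_iff₀ (cocycle_ne_zero Θ _ _), ← translation_zero Θ]
    ext1 f
    have := translation_mul Θ x (-x) f
    rw [add_neg_cancel] at this
    exact this
  exact left_inv_eq_right_inv h1 h2

theorem NCTorus.toCLM_rightTranslation {Θ : Matrix (Fin m) (Fin m) ℝ} (a : NCTorus Θ)
    (x : Fin m → ℤ) (f : L2Z m) :
    toCLM a (rightTranslation Θ x f) = rightTranslation Θ x (toCLM a f) := by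
  have hcl : IsClosed {T : L2Z m →L[ℂ] L2Z m |
      T (rightTranslation Θ x f) = rightTranslation Θ x (T f)} :=
    isClosed_eq (by fun_prop) ((rightTranslation Θ x).continuous.comp (by fun_prop))
  refine closure_minimal ?_ hcl a.2
  -- The vector is generalized because the product case applies the hypothesis on `S` at `T f`.
  suffices h : ∀ T ∈ StarAlgebra.adjoin ℂ
      (Set.range fun x : Fin m → ℤ => (translation Θ x).toContinuousLinearMap),
      ∀ f, T (rightTranslation Θ x f) = rightTranslation Θ x (T f) from fun T hT => h T hT f
  intro T hT
  have key : ∀ y f, (translation Θ y).toContinuousLinearMap (rightTranslation Θ x f) =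
      rightTranslation Θ x ((translation Θ y).toContinuousLinearMap f) :=
    fun y f => translation_rightTranslation Θ y x f
  induction hT using Algebra.adjoin_induction with
  | mem T hT =>
    -- The star subalgebra is generated as an algebra by the translations together with their
    -- adjoints.
    rcases hT with ⟨y, rfl⟩ | ⟨y, hy⟩
    · exact key y
    · intro f
      have hy' : T = star (translation Θ y).toContinuousLinearMap := (star_eq_iff_star_eq.1 hy.symm).symm
      rw [hy', star_translation, smul_apply, smul_apply, key, map_smul]
  | algebraMap c =>
    intro f
    simp [Algebra.algebraMap_eq_smul_one]
  | add S T _ _ hS hT =>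
    intro f
    rw [add_apply, add_apply, hS, hT, map_add]
  | mul S T _ _ hS hT =>
    intro f
    rw [mul_apply_eq_comp, mul_apply_eq_comp, hT, hS]

theorem lp_clm_ext {F : Type*} [NormedAddCommGroup F] [NormedSpace ℂ F] {T S : L2Z m →L[ℂ] F}
    (h : ∀ x, T (lp.single 2 x 1) = S (lp.single 2 x 1)) : T = S := by
  ext f
  have h1 := lp.hasSum_single (p := 2) (by norm_num) f
  have h2 : ∀ x, T (lp.single 2 x (f x)) = S (lp.single 2 x (f x)) := by
    intro x
    have : (lp.single 2 x (f x) : L2Z m) = f x • lp.single 2 x (1 : ℂ) := by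
      rw [← lp.single_smul, smul_eq_mul, mul_one]
    rw [this, map_smul, map_smul, h]
  have h3 := (T.hasSum h1)
  have h4 := (S.hasSum h1)
  exact h3.unique (h4.congr_fun h2)

/-- The canonical trace on the noncommutative torus is faithful. -/
theorem NCTorus.eq_zero_of_trace_star_mul_self {Θ : Matrix (Fin m) (Fin m) ℝ} {a : NCTorus Θ}
    (h : trace (star a * a) = 0) : a = 0 := by
  have h1 : trace (star a * a) =
      ⟪(lp.single 2 0 1 : L2Z m), toCLM (star a * a) (lp.single 2 0 1)⟫_ℂ := by
    rw [lp.inner_single_left]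
    simp [trace, coeff]
  rw [h1, map_mul, map_star, ContinuousLinearMap.star_eq_adjoint, mul_apply_eq_comp,
    ContinuousLinearMap.adjoint_inner_right, inner_self_eq_zero] at h
  -- At this point `h` says `a δ_0 = 0`; then `a δ_x = R_x a δ_0 = 0` for every right translation
  -- `R_x`.
  refine Subtype.ext (lp_clm_ext fun x => ?_)
  change toCLM a (lp.single 2 x 1) = (0 : L2Z m →L[ℂ] L2Z m) (lp.single 2 x 1)
  rw [← rightTranslation_single_zero Θ, toCLM_rightTranslation, h, map_zero, zero_apply]

end RightTranslation

/-- The normalized trace on `M_r(A_Θ)` is faithful. -/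
theorem MatTorus.eq_zero_of_trace_star_mul_self {r m : ℕ} {Θ : Matrix (Fin m) (Fin m) ℝ}
    {b : MatTorus r Θ} (h : MatTorus.trace (star b * b) = 0) : b = 0 := by
  have h1 : MatTorus.trace (star b * b) =
      (r : ℂ)⁻¹ * ∑ i, ∑ k, NCTorus.trace (star (b.entry k i) * b.entry k i) := by
    have h2 : MatTorus.trace (star b * b) =
        (r : ℂ)⁻¹ * ∑ i, NCTorus.trace ((star b * b).entry i i) := rfl
    rw [h2]
    congr 1
    refine Finset.sum_congr rfl fun i _ => ?_
    have h : (star b * b).entry i i = ∑ k, star (b.entry k i) * b.entry k i := rfl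
    rw [h, map_sum]
  have hz : ∀ i k, b.entry k i = 0 := by
    intro i k
    -- The index `i` itself shows `r > 0`; for `r = 0` there is no entry to check.
    have hr : (r : ℂ) ≠ 0 := Nat.cast_ne_zero.2 (Fin.pos i).ne'
    rw [h1, mul_eq_zero, or_iff_right (inv_ne_zero hr)] at h
    have hnn : ∀ i k, 0 ≤ NCTorus.trace (star (b.entry k i) * b.entry k i) :=
      fun i k => NCTorus.trace_star_mul_self_nonneg _
    have h3 := (Finset.sum_eq_zero_iff_of_nonneg fun i _ =>
      Finset.sum_nonneg fun k _ => hnn i k).1 h i (Finset.mem_univ _)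
    exact NCTorus.eq_zero_of_trace_star_mul_self
      ((Finset.sum_eq_zero_iff_of_nonneg fun k _ => hnn i k).1 h3 k (Finset.mem_univ _))
  exact CStarMatrix.ext fun i j => hz j i

/-! ### Left multiplication on `L²(A, τ) ⊗ S` -/

namespace L2Tensor

variable {A : Type*} [NonUnitalCStarAlgebra A] [PartialOrder A] [StarOrderedRing A]
  (τ : A →ₚ[ℂ] ℂ) {S : Type*} [NormedAddCommGroup S] [InnerProductSpace ℂ S]

theorem denseRange_ofTensor : DenseRange (ofTensor τ (S := S)) :=
  UniformSpace.Completion.denseRange_coe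

theorem clm_ext {F : Type*} [NormedAddCommGroup F] [NormedSpace ℂ F] {T T' : L2Tensor τ S →L[ℂ] F}
    (h : ∀ x, T (ofTensor τ x) = T' (ofTensor τ x)) : T = T' :=
  ContinuousLinearMap.coeFn_injective
    ((denseRange_ofTensor τ).equalizer T.continuous T'.continuous (funext h))

/-- On elementary tensors this is the `*`-property of the GNS representation. It gives `map_star'`
of `leftMulHom` by density. -/
theorem inner_rTensor (a : A) (x y : τ.GNS ⊗[ℂ] S) :
    ⟪(τ.gnsNonUnitalStarAlgHom (star a) : τ.GNS →ₗ[ℂ] τ.GNS).rTensor S x, y⟫_ℂ =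
      ⟪x, (τ.gnsNonUnitalStarAlgHom a : τ.GNS →ₗ[ℂ] τ.GNS).rTensor S y⟫_ℂ := by
  induction x with
  | zero => simp
  | add x x' hx hx' => rw [map_add, inner_add_left, inner_add_left, hx, hx']
  | tmul u s =>
    induction y with
    | zero => simp
    | add y y' hy hy' => rw [map_add, inner_add_right, inner_add_right, hy, hy']
    | tmul v t =>
      rw [LinearMap.rTensor_tmul, LinearMap.rTensor_tmul, TensorProduct.inner_tmul,
        TensorProduct.inner_tmul, map_star, ContinuousLinearMap.star_eq_adjoint,
        ContinuousLinearMap.coe_coe, ContinuousLinearMap.coe_coe,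
        ContinuousLinearMap.adjoint_inner_left]

theorem norm_vec (a : A) (ξ : S) : ‖vec τ a ξ‖ = √(τ (star a * a)).re * ‖ξ‖ := by
  rw [vec, LinearIsometry.norm_map, TensorProduct.norm_tmul, UniformSpace.Completion.norm_coe,
    PositiveLinearMap.preGNS_norm_def]
  rfl

/-- Left multiplication as a `*`-representation. -/
def leftMulHom (S : Type*) [NormedAddCommGroup S] [InnerProductSpace ℂ S]
    [FiniteDimensional ℂ S] : A →⋆ₙₐ[ℂ] (L2Tensor τ S →L[ℂ] L2Tensor τ S) where
  toFun := leftMul τ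
  map_smul' c a := clm_ext τ fun x => by
    rw [smul_apply, leftMul_ofTensor, leftMul_ofTensor]
    refine (congrArg (ofTensor τ) ?_).trans ((ofTensor τ).map_smul c _)
    rw [map_smul]
    exact congrArg (fun T : τ.GNS ⊗[ℂ] S →ₗ[ℂ] τ.GNS ⊗[ℂ] S => T x)
      (LinearMap.rTensor_smul S c (τ.gnsNonUnitalStarAlgHom a : τ.GNS →ₗ[ℂ] τ.GNS))
  map_zero' := clm_ext τ fun x => by
    rw [leftMul_ofTensor, map_zero]
    simp
  map_add' a b := clm_ext τ fun x => by
    rw [add_apply, leftMul_ofTensor, leftMul_ofTensor, leftMul_ofTensor]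
    refine (congrArg (ofTensor τ) ?_).trans ((ofTensor τ).map_add _ _)
    rw [map_add]
    exact congrArg (fun T : τ.GNS ⊗[ℂ] S →ₗ[ℂ] τ.GNS ⊗[ℂ] S => T x)
      (LinearMap.rTensor_add S (τ.gnsNonUnitalStarAlgHom a : τ.GNS →ₗ[ℂ] τ.GNS)
        (τ.gnsNonUnitalStarAlgHom b : τ.GNS →ₗ[ℂ] τ.GNS))
  map_mul' a b := clm_ext τ fun x => by
    rw [mul_apply_eq_comp, leftMul_ofTensor, leftMul_ofTensor, leftMul_ofTensor, map_mul]
    congr 1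
    exact LinearMap.rTensor_comp_apply S (τ.gnsNonUnitalStarAlgHom a : τ.GNS →ₗ[ℂ] τ.GNS)
      (τ.gnsNonUnitalStarAlgHom b : τ.GNS →ₗ[ℂ] τ.GNS) x
  map_star' a := by
    rw [ContinuousLinearMap.star_eq_adjoint, ContinuousLinearMap.eq_adjoint_iff]
    intro x y
    refine (denseRange_ofTensor τ).induction_on₂ (p := fun x y =>
      ⟪leftMul τ (star a) x, y⟫_ℂ = ⟪x, leftMul τ a y⟫_ℂ) ?_ ?_ x y
    · exact isClosed_eq (by fun_prop) (by fun_prop)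
    · intro x y
      rw [leftMul_ofTensor, leftMul_ofTensor, LinearIsometry.inner_map_map,
        LinearIsometry.inner_map_map, inner_rTensor]

theorem leftMulHom_apply [FiniteDimensional ℂ S] (a : A) : leftMulHom τ S a = leftMul τ a := rfl

end L2Tensor

/-- The representation of `M_r(A_Θ)` on `L²(M_r(A_Θ)) ⊗ S` is faithful if `S ≠ 0`. -/
theorem MatTorus.leftMulHom_injective {r m : ℕ} {Θ : Matrix (Fin m) (Fin m) ℝ} (S : Type*)
    [NormedAddCommGroup S] [InnerProductSpace ℂ S] [FiniteDimensional ℂ S] [Nontrivial S] :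
    Function.Injective (L2Tensor.leftMulHom (MatTorus.trace (r := r) (Θ := Θ)) S) := by
  rw [injective_iff_map_eq_zero]
  intro b hb
  obtain ⟨ξ, hξ⟩ := exists_ne (0 : S)
  have h1 : L2Tensor.vec (MatTorus.trace (r := r) (Θ := Θ)) b ξ = 0 := by
    -- Evaluation at `Λ(1) ⊗ ξ` with `ξ ≠ 0` yields `Λ(b) ⊗ ξ = 0`, whose squared norm is `τ(b^* b)
    -- ‖ξ‖²`.
    have := L2Tensor.leftMul_vec (MatTorus.trace (r := r) (Θ := Θ)) b 1 ξ
    rw [mul_one, ← L2Tensor.leftMulHom_apply, hb, zero_apply] at this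
    exact this.symm
  rw [← norm_eq_zero, L2Tensor.norm_vec, mul_eq_zero, or_iff_left (norm_ne_zero_iff.2 hξ)] at h1
  have h2 : 0 ≤ MatTorus.trace (star b * b) :=
    (MatTorus.trace (r := r) (Θ := Θ)).map_nonneg (star_mul_self_nonneg b)
  -- The norm sees only the real part of `τ(b^* b)`; positivity disposes of the imaginary part.
  obtain ⟨h3, h4⟩ := Complex.le_def.1 h2
  have h5 := (Real.sqrt_eq_zero h3).1 h1
  exact MatTorus.eq_zero_of_trace_star_mul_self (Complex.ext h5 h4.symm)

/-! ### Intertwined selfadjoint operators and commutators -/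

section Unbounded

variable {E F H : Type*} [NormedAddCommGroup E] [InnerProductSpace ℂ E]
  [NormedAddCommGroup F] [InnerProductSpace ℂ F] [NormedAddCommGroup H] [InnerProductSpace ℂ H]

theorem Intertwines.map_mem_graph {V : E →ₗᵢ[ℂ] F} {D : E →ₗ.[ℂ] E} {D' : F →ₗ.[ℂ] F}
    (h : Intertwines V D D') {x y : E} (hxy : (x, y) ∈ D.graph) : (V x, V y) ∈ D'.graph := by
  rw [LinearPMap.mem_graph_iff] at hxy
  obtain ⟨u, rfl, rfl⟩ := hxy
  obtain ⟨h1, h2⟩ := h u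
  rw [LinearPMap.mem_graph_iff]
  exact ⟨⟨_, h1⟩, rfl, h2⟩

theorem Intertwines.comp {G : Type*} [NormedAddCommGroup G] [InnerProductSpace ℂ G]
    {W : F →ₗᵢ[ℂ] G} {V : E →ₗᵢ[ℂ] F} {D : E →ₗ.[ℂ] E} {D' : F →ₗ.[ℂ] F} {D'' : G →ₗ.[ℂ] G}
    (hW : Intertwines W D' D'') (hV : Intertwines V D D') : Intertwines (W.comp V) D D'' := by
  intro x
  obtain ⟨h1, h2⟩ := hV x
  obtain ⟨h3, h4⟩ := hW ⟨V x, h1⟩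
  exact ⟨h3, h4.trans (congrArg W h2)⟩

/-- The graph form absorbs the domain condition, so it can be transported along isometries and
passed to closures. -/
theorem commutatorExtendsTo_iff {D : H →ₗ.[ℂ] H} {a T : H →L[ℂ] H} :
    CommutatorExtendsTo D a T ↔
      ∀ x y, (x, y) ∈ D.graph → (a x, a y + T x) ∈ D.graph := by
  constructor
  · intro h x y hxy
    rw [LinearPMap.mem_graph_iff] at hxy ⊢
    obtain ⟨u, rfl, rfl⟩ := hxy
    obtain ⟨h1, h2⟩ := h u
    exact ⟨⟨_, h1⟩, rfl, sub_eq_iff_eq_add'.1 h2⟩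
  · intro h x
    have h1 := h _ _ (LinearPMap.mem_graph D x)
    rw [LinearPMap.mem_graph_iff] at h1
    obtain ⟨u, hu, hu'⟩ := h1
    dsimp only at hu hu'
    have h2 : a x ∈ D.domain := hu ▸ u.2
    have h3 : u = ⟨a x, h2⟩ := Subtype.ext hu
    exact ⟨h2, by rw [← h3, hu', add_sub_cancel_left]⟩

/-- Commutators of intertwined operators are intertwined. -/
theorem CommutatorExtendsTo.intertwine {V : E →ₗᵢ[ℂ] F} {D : E →ₗ.[ℂ] E} {D' : F →ₗ.[ℂ] F}
    (hV : Intertwines V D D') (hd : Dense (D.domain : Set E)) {a T : E →L[ℂ] E}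
    {a' T' : F →L[ℂ] F} (ha : ∀ x, a' (V x) = V (a x)) (hT : CommutatorExtendsTo D a T)
    (hT' : CommutatorExtendsTo D' a' T') (x : E) : T' (V x) = V (T x) := by
  refine congrFun (Continuous.ext_on (f := fun x => T' (V x)) (g := fun x => V (T x)) hd
    (T'.continuous.comp V.continuous) (V.continuous.comp T.continuous) ?_) x
  intro u hu
  have hg := LinearPMap.mem_graph D ⟨u, hu⟩
  have h1 := hV.map_mem_graph (commutatorExtendsTo_iff.1 hT _ _ hg)
  have h2 := commutatorExtendsTo_iff.1 hT' _ _ (hV.map_mem_graph hg)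
  -- `h1` and `h2` are points of the graph of `D'` over the same vector `V (a u)`, so their second
  -- coordinates agree.
  have h3 := LinearPMap.mem_graph_snd_inj D' h1 h2 (ha _).symm
  rw [map_add, ha, add_right_inj] at h3
  exact h3.symm

/-! ### Consequences of selfadjointness in graph form -/

variable [CompleteSpace E] [CompleteSpace F]

theorem inner_graph_of_isSelfAdjoint {D : E →ₗ.[ℂ] E} (hD : IsSelfAdjoint D) {x y x' y' : E}
    (h : (x, y) ∈ D.graph) (h' : (x', y') ∈ D.graph) : ⟪y, x'⟫_ℂ = ⟪x, y'⟫_ℂ := by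
  have hadj : D.adjoint = D := hD
  have hf : D.IsFormalAdjoint D := by
    have := LinearPMap.adjoint_isFormalAdjoint hD.dense_domain
    rwa [hadj] at this
  rw [LinearPMap.mem_graph_iff] at h h'
  obtain ⟨u, rfl, rfl⟩ := h
  obtain ⟨v, rfl, rfl⟩ := h'
  exact hf u v

/-- This is the inclusion of the adjoint in `D`, the maximality that a merely symmetric operator
lacks. -/
theorem mem_graph_of_isSelfAdjoint {D : E →ₗ.[ℂ] E} (hD : IsSelfAdjoint D) {y w : E}
    (h : ∀ x : D.domain, ⟪w, (x : E)⟫_ℂ = ⟪y, D x⟫_ℂ) : (y, w) ∈ D.graph := by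
  have hadj : D.adjoint = D := hD
  have hy := D.mem_adjoint_domain_of_exists y ⟨w, h⟩
  have h1 : D.adjoint ⟨y, hy⟩ = w := LinearPMap.adjoint_apply_eq hD.dense_domain _ h
  have h2 : (y, w) ∈ D.adjoint.graph := h1 ▸ LinearPMap.mem_graph D.adjoint ⟨y, hy⟩
  rwa [hadj] at h2

/-- If an isometry `V` intertwines selfadjoint operators `D` and `D'`, the part of `D'` in the
range of `V` is the image of `D`. -/
theorem Intertwines.exists_of_mem_graph {V : E →ₗᵢ[ℂ] F} {D : E →ₗ.[ℂ] E} {D' : F →ₗ.[ℂ] F}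
    (hV : Intertwines V D D') (hD : IsSelfAdjoint D) (hD' : IsSelfAdjoint D') {y : E} {w : F}
    (h : (V y, w) ∈ D'.graph) : ∃ z, w = V z ∧ (y, z) ∈ D.graph := by
  -- The candidate is `V^* w`, since `⟨V^* w, x⟩ = ⟨w, V x⟩ = ⟨V y, V D x⟩ = ⟨y, D x⟩` by symmetry
  -- of `D'`. Pushed back by `V`, it sits over `V y` as `w` does, so `w = V V^* w`.
  have h1 : (y, V.toContinuousLinearMap.adjoint w) ∈ D.graph := by
    refine mem_graph_of_isSelfAdjoint hD fun x => ?_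
    rw [ContinuousLinearMap.adjoint_inner_left]
    refine (inner_graph_of_isSelfAdjoint hD' h
      (hV.map_mem_graph (LinearPMap.mem_graph D x))).trans ?_
    exact V.inner_map_map _ _
  exact ⟨_, LinearPMap.mem_graph_snd_inj D' h (hV.map_mem_graph h1) rfl, h1⟩

/-- A bounded commutator compresses along an intertwining isometry. -/
theorem CommutatorExtendsTo.compression {V : E →ₗᵢ[ℂ] F} {D : E →ₗ.[ℂ] E} {D' : F →ₗ.[ℂ] F}
    (hV : Intertwines V D D') (hD : IsSelfAdjoint D) (hD' : IsSelfAdjoint D')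
    {a : E →L[ℂ] E} {a' T : F →L[ℂ] F} (ha : ∀ x, a' (V x) = V (a x))
    (hT : CommutatorExtendsTo D' a' T) :
    CommutatorExtendsTo D a
      (V.toContinuousLinearMap.adjoint ∘L T ∘L V.toContinuousLinearMap) := by
  rw [commutatorExtendsTo_iff]
  intro x y hxy
  have h1 := commutatorExtendsTo_iff.1 hT _ _ (hV.map_mem_graph hxy)
  rw [ha, ha] at h1
  -- Over `V (a x)` the value of `D'` lies in the range of `V`, so applying `V^*` loses nothing.
  obtain ⟨z, hz, hz'⟩ := hV.exists_of_mem_graph hD hD' h1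
  have h2 : V.toContinuousLinearMap.adjoint (V (a y) + T (V x)) = z := by
    rw [hz, V.adjoint_apply_self]
  rw [map_add, V.adjoint_apply_self] at h2
  rw [← h2] at hz'
  exact hz'

end Unbounded

/-! ### Inductive limits of selfadjoint operators -/

section LimitOperator

variable {E : ℕ → Type*} [∀ n, NormedAddCommGroup (E n)] [∀ n, InnerProductSpace ℂ (E n)]
  (V : ∀ n, E n →ₗᵢ[ℂ] E (n + 1)) (D : ∀ n, E n →ₗ.[ℂ] E n)

/-- The image of the graph of `D_n` in the limit. -/
def stageGraph (n : ℕ) : Submodule ℂ (HilbertLimit V × HilbertLimit V) :=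
  (D n).graph.map ((toHilbertLimit V n).toLinearMap.prodMap (toHilbertLimit V n).toLinearMap)

/-- The union of the images of the graphs of the `D_n`. -/
def limitGraph : Submodule ℂ (HilbertLimit V × HilbertLimit V) := ⨆ n, stageGraph V D n

variable {V D}

theorem mem_stageGraph {n : ℕ} {q : HilbertLimit V × HilbertLimit V} :
    q ∈ stageGraph V D n ↔
      ∃ x y, (x, y) ∈ (D n).graph ∧ q = (toHilbertLimit V n x, toHilbertLimit V n y) := by
  constructor
  · rintro ⟨⟨x, y⟩, h, rfl⟩
    exact ⟨x, y, h, rfl⟩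
  · rintro ⟨x, y, h, rfl⟩
    exact ⟨(x, y), h, rfl⟩

/-- Intertwining pushes each stage graph into the next. Monotonicity makes the supremum in
`limitGraph` a plain union. -/
theorem stageGraph_mono (hV : ∀ n, Intertwines (V n) (D n) (D (n + 1))) :
    Monotone (stageGraph V D) := by
  refine monotone_nat_of_le_succ fun n q hq => ?_
  obtain ⟨x, y, h, rfl⟩ := mem_stageGraph.1 hq
  exact mem_stageGraph.2 ⟨_, _, (hV n).map_mem_graph h, by
    rw [toHilbertLimit_succ, toHilbertLimit_succ]⟩

theorem mem_limitGraph (hV : ∀ n, Intertwines (V n) (D n) (D (n + 1)))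
    {q : HilbertLimit V × HilbertLimit V} : q ∈ limitGraph V D ↔ ∃ n, q ∈ stageGraph V D n :=
  Submodule.mem_iSup_of_directed _ (stageGraph_mono hV).directed_le

theorem exists_ge_mem_stageGraph (hV : ∀ n, Intertwines (V n) (D n) (D (n + 1))) (n₀ : ℕ)
    {q : HilbertLimit V × HilbertLimit V} (hq : q ∈ limitGraph V D) :
    ∃ n ≥ n₀, q ∈ stageGraph V D n := by
  obtain ⟨n, hn⟩ := (mem_limitGraph hV).1 hq
  exact ⟨max n n₀, le_max_right _ _, stageGraph_mono hV (le_max_left _ _) hn⟩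

/-! ### Symmetry, closability and selfadjointness of the limit operator -/

variable [∀ n, CompleteSpace (E n)]

/-- Any two points of the union lie in one stage graph, where symmetry of `D_k` applies. -/
theorem inner_limitGraph (hV : ∀ n, Intertwines (V n) (D n) (D (n + 1)))
    (hD : ∀ n, IsSelfAdjoint (D n)) {q q' : HilbertLimit V × HilbertLimit V}
    (hq : q ∈ limitGraph V D) (hq' : q' ∈ limitGraph V D) : ⟪q.2, q'.1⟫_ℂ = ⟪q.1, q'.2⟫_ℂ := by
  obtain ⟨n, hn⟩ := (mem_limitGraph hV).1 hq'
  obtain ⟨k, hk, h⟩ := exists_ge_mem_stageGraph hV n hq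
  obtain ⟨x, y, h1, rfl⟩ := mem_stageGraph.1 h
  obtain ⟨x', y', h2, rfl⟩ := mem_stageGraph.1 (stageGraph_mono hV hk hn)
  dsimp only
  rw [LinearIsometry.inner_map_map, LinearIsometry.inner_map_map,
    inner_graph_of_isSelfAdjoint (hD k) h1 h2]

theorem inner_closure_limitGraph (hV : ∀ n, Intertwines (V n) (D n) (D (n + 1)))
    (hD : ∀ n, IsSelfAdjoint (D n)) {q q' : HilbertLimit V × HilbertLimit V}
    (hq : q ∈ (limitGraph V D).topologicalClosure)
    (hq' : q' ∈ (limitGraph V D).topologicalClosure) : ⟪q.2, q'.1⟫_ℂ = ⟪q.1, q'.2⟫_ℂ := by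
  have h1 : ∀ q ∈ limitGraph V D, ∀ q' ∈ (limitGraph V D).topologicalClosure,
      ⟪q.2, q'.1⟫_ℂ = ⟪q.1, q'.2⟫_ℂ := fun q hq q' hq' =>
    closure_minimal (t := {q' : HilbertLimit V × HilbertLimit V | ⟪q.2, q'.1⟫_ℂ = ⟪q.1, q'.2⟫_ℂ})
      (fun q' hq' => inner_limitGraph hV hD hq hq')
      (isClosed_eq (by fun_prop) (by fun_prop)) hq'
  exact closure_minimal (t := {q : HilbertLimit V × HilbertLimit V | ⟪q.2, q'.1⟫_ℂ = ⟪q.1, q'.2⟫_ℂ})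
      (fun q hq => h1 q hq q' hq')
      (isClosed_eq (by fun_prop) (by fun_prop)) hq

theorem dense_fst_limitGraph (hD : ∀ n, IsSelfAdjoint (D n)) :
    Dense {x : HilbertLimit V | ∃ y, (x, y) ∈ limitGraph V D} := by
  rw [← dense_closure]
  refine (dense_toHilbertLimit V 0).mono ?_
  rintro _ ⟨n, -, x, rfl⟩
  have h := mem_closure_image (toHilbertLimit V n).continuous.continuousAt
    ((hD n).dense_domain x)
  refine closure_mono ?_ h
  rintro _ ⟨u, hu, rfl⟩
  exact ⟨toHilbertLimit V n (D n ⟨u, hu⟩), Submodule.mem_iSup_of_mem n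
    (mem_stageGraph.2 ⟨_, _, LinearPMap.mem_graph (D n) ⟨u, hu⟩, rfl⟩)⟩

/-- A densely defined symmetric operator is closable: if `q.1 = 0`, then `q.2` is orthogonal to the
dense set of first coordinates. -/
theorem snd_eq_zero_of_mem_closure_limitGraph (hV : ∀ n, Intertwines (V n) (D n) (D (n + 1)))
    (hD : ∀ n, IsSelfAdjoint (D n)) (q : HilbertLimit V × HilbertLimit V)
    (hq : q ∈ (limitGraph V D).topologicalClosure) (h0 : q.1 = 0) : q.2 = 0 := by
  refine (dense_fst_limitGraph (V := V) hD).eq_zero_of_inner_left ℂ ?_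
  rintro x ⟨y, hy⟩
  have := inner_closure_limitGraph hV hD hq (Submodule.le_topologicalClosure _ hy)
  rw [h0, inner_zero_left] at this
  exact this

variable (V D) in
/-- The closure of the operator whose graph is the union of the images of the graphs. -/
def limitOperator : HilbertLimit V →ₗ.[ℂ] HilbertLimit V := (limitGraph V D).toLinearPMap.closure

/-- `toLinearPMap` and `closure` have the intended graphs only for single-valued and closable data;
the preceding lemma supplies both. -/
theorem graph_limitOperator (hV : ∀ n, Intertwines (V n) (D n) (D (n + 1)))
    (hD : ∀ n, IsSelfAdjoint (D n)) :
    (limitOperator V D).graph = (limitGraph V D).topologicalClosure := by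
  have h1 : (limitGraph V D).toLinearPMap.graph = limitGraph V D :=
    Submodule.toLinearPMap_graph_eq _ fun q hq =>
      snd_eq_zero_of_mem_closure_limitGraph hV hD q (Submodule.le_topologicalClosure _ hq)
  have h2 : (limitGraph V D).toLinearPMap.IsClosable :=
    ⟨(limitGraph V D).topologicalClosure.toLinearPMap, by
      rw [h1, Submodule.toLinearPMap_graph_eq _ fun q hq =>
        snd_eq_zero_of_mem_closure_limitGraph hV hD q hq]⟩
  rw [limitOperator, ← h2.graph_closure_eq_closure_graph, h1]

theorem intertwines_limitOperator (hV : ∀ n, Intertwines (V n) (D n) (D (n + 1)))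
    (hD : ∀ n, IsSelfAdjoint (D n)) (n : ℕ) :
    Intertwines (toHilbertLimit V n) (D n) (limitOperator V D) := by
  intro x
  have h : (toHilbertLimit V n x, toHilbertLimit V n (D n x)) ∈ (limitOperator V D).graph := by
    rw [graph_limitOperator hV hD]
    exact Submodule.le_topologicalClosure _ (Submodule.mem_iSup_of_mem n
      (mem_stageGraph.2 ⟨_, _, LinearPMap.mem_graph (D n) x, rfl⟩))
  rw [LinearPMap.mem_graph_iff] at h
  obtain ⟨u, hu, hu'⟩ := h
  dsimp only at hu hu'
  have h2 : toHilbertLimit V n x ∈ (limitOperator V D).domain := hu ▸ u.2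
  have h3 : u = ⟨_, h2⟩ := Subtype.ext hu
  exact ⟨h2, by rw [← h3, hu']⟩

theorem dense_domain_limitOperator (hV : ∀ n, Intertwines (V n) (D n) (D (n + 1)))
    (hD : ∀ n, IsSelfAdjoint (D n)) :
    Dense ((limitOperator V D).domain : Set (HilbertLimit V)) := by
  refine (dense_fst_limitGraph (V := V) hD).mono ?_
  rintro x ⟨y, hy⟩
  have h : (x, y) ∈ (limitOperator V D).graph := by
    rw [graph_limitOperator hV hD]
    exact Submodule.le_topologicalClosure _ hy
  exact LinearPMap.mem_domain_of_mem_graph h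

/-- An inductive limit of selfadjoint operators along intertwining isometries is selfadjoint. -/
theorem isSelfAdjoint_limitOperator (hV : ∀ n, Intertwines (V n) (D n) (D (n + 1)))
    (hD : ∀ n, IsSelfAdjoint (D n)) : IsSelfAdjoint (limitOperator V D) := by
  have hd := dense_domain_limitOperator hV hD
  rw [LinearPMap.isSelfAdjoint_def]
  refine LinearPMap.eq_of_eq_graph ?_
  rw [LinearPMap.adjoint_graph_eq_graph_adjoint hd, graph_limitOperator hV hD]
  ext ⟨y, w⟩
  rw [Submodule.mem_adjoint_iff]
  constructor
  · intro h
    -- The compressed pair satisfies the adjoint relation of the selfadjoint `D_n`, so it lies in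
    -- the graph of `D_n` itself.
    have key : ∀ n, (stageProj V n y, stageProj V n w) ∈ limitGraph V D := by
      intro n
      refine Submodule.mem_iSup_of_mem n (mem_stageGraph.2
        ⟨(toHilbertLimit V n).toContinuousLinearMap.adjoint y,
          (toHilbertLimit V n).toContinuousLinearMap.adjoint w, ?_, rfl⟩)
      refine mem_graph_of_isSelfAdjoint (hD n) fun x => ?_
      rw [ContinuousLinearMap.adjoint_inner_left, ContinuousLinearMap.adjoint_inner_left]
      have h1 := sub_eq_zero.1 (h _ _ (Submodule.le_topologicalClosure _
        (Submodule.mem_iSup_of_mem n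
          (mem_stageGraph.2 ⟨_, _, LinearPMap.mem_graph (D n) x, rfl⟩))))
      -- The adjoint of a submodule is defined with the inner products in the opposite order.
      have h2 := congrArg (starRingEnd ℂ) h1
      rw [inner_conj_symm, inner_conj_symm] at h2
      exact h2.symm
    exact mem_closure_of_tendsto ((tendsto_stageProj V y).prodMk_nhds (tendsto_stageProj V w))
      (Eventually.of_forall key)
  · intro h x z hxz
    exact sub_eq_zero.2 (inner_closure_limitGraph hV hD hxz h)

/-- Compatible bounded commutators pass to the limit. -/
theorem commutatorExtendsTo_limitOperator (hV : ∀ n, Intertwines (V n) (D n) (D (n + 1)))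
    (hD : ∀ n, IsSelfAdjoint (D n)) (n₀ : ℕ) {a T : HilbertLimit V →L[ℂ] HilbertLimit V}
    {a' T' : ∀ n, E n →L[ℂ] E n}
    (ha : ∀ n ≥ n₀, ∀ x, a (toHilbertLimit V n x) = toHilbertLimit V n (a' n x))
    (hT : ∀ n ≥ n₀, ∀ x, T (toHilbertLimit V n x) = toHilbertLimit V n (T' n x))
    (h : ∀ n ≥ n₀, CommutatorExtendsTo (D n) (a' n) (T' n)) :
    CommutatorExtendsTo (limitOperator V D) a T := by
  rw [commutatorExtendsTo_iff, graph_limitOperator hV hD]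
  intro x y hxy
  -- The commutator relation says that this continuous map preserves the graph, so invariance of the
  -- union gives invariance of its closure.
  let Φ : HilbertLimit V × HilbertLimit V → HilbertLimit V × HilbertLimit V :=
    fun q => (a q.1, a q.2 + T q.1)
  have hc : Continuous Φ := by fun_prop
  suffices hmap : Set.MapsTo Φ (limitGraph V D) (limitGraph V D) from
    map_mem_closure (f := Φ) hc hxy hmap
  intro q hq
  obtain ⟨n, hn, hq⟩ := exists_ge_mem_stageGraph hV n₀ hq
  obtain ⟨u, v, huv, rfl⟩ := mem_stageGraph.1 hq
  refine Submodule.mem_iSup_of_mem n (mem_stageGraph.2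
    ⟨_, _, commutatorExtendsTo_iff.1 (h n hn) _ _ huv, ?_⟩)
  simp only [Φ]
  rw [ha n hn, ha n hn, hT n hn, map_add]

end LimitOperator

/-! ### The limit representation -/

namespace MoritaDirac

variable {X : ProtoralSystem} (M : MoritaDirac X)

theorem I_rep (n : ℕ) (b : X.B n) (η : M.H n) :
    M.I n (M.rep n b η) = M.rep (n + 1) (X.φ n b) (M.I n η) := by
  change M.Iι n (M.Iα n (M.Iψ n (L2Tensor.leftMul (X.τ n) b η))) = _
  rw [M.rep_ψ, M.rep_α, M.rep_ι, M.factor]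
  rfl

theorem intertwines_I (n : ℕ) : Intertwines (M.I n) (M.D n) (M.D (n + 1)) :=
  (M.intertwines_ι n).comp ((M.intertwines_α n).comp (M.intertwines_ψ n))

/-- The representation `π_n` as a `*`-homomorphism. -/
def repHom (n : ℕ) : X.B n →⋆ₙₐ[ℂ] (M.H n →L[ℂ] M.H n) := L2Tensor.leftMulHom (X.τ n) (M.S n)

theorem rep_eq (n : ℕ) (b : X.B n) : M.rep n b = M.repHom n b := rfl

theorem norm_rep_le (n : ℕ) (b : X.B n) : ‖M.rep n b‖ ≤ ‖b‖ :=
  NonUnitalStarAlgHom.norm_apply_le (M.repHom n) b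

theorem exists_stageRep (n : ℕ) (b : X.B n) :
    ∃ S : M.Hpro →L[ℂ] M.Hpro, ∀ (k : ℕ) (h : n ≤ k) (η : M.H k),
      S (M.Iinf k η) = M.Iinf k (M.rep k (X.φTo h b) η) := by
  -- Stages before `n` are filled with zero. Since `*`-homomorphisms are contractive, `‖b‖` bounds
  -- every stage.
  let T : ∀ k, M.H k →L[ℂ] M.H k := fun k => if h : n ≤ k then M.rep k (X.φTo h b) else 0
  have hT : ∀ k (h : n ≤ k), T k = M.rep k (X.φTo h b) := fun k h => dif_pos h
  obtain ⟨S, hS⟩ := exists_limit_operator (E := M.H) M.I n T ‖b‖ (fun k => by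
      by_cases h : n ≤ k
      · rw [hT k h]
        exact (M.norm_rep_le k _).trans (norm_homTo_le h b)
      · simp [T, h])
    (fun k hk x => by
      rw [hT k hk, hT (k + 1) (Nat.le_succ_of_le hk), I_rep, ← homTo_succ X.φ hk])
  exact ⟨S, fun k h η => by rw [← hT k h]; exact hS k h η⟩

/-- The representation of `B_n` on `H_pro`, before passing to the limit algebra. -/
def stageRepFun (n : ℕ) (b : X.B n) : M.Hpro →L[ℂ] M.Hpro := (M.exists_stageRep n b).choose

theorem stageRepFun_apply {n k : ℕ} (h : n ≤ k) (b : X.B n) (η : M.H k) :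
    M.stageRepFun n b (M.Iinf k η) = M.Iinf k (M.rep k (X.φTo h b) η) :=
  (M.exists_stageRep n b).choose_spec k h η

/-- The representation of `B_n` on `H_pro`. -/
def stageRep (n : ℕ) : X.B n →⋆ₙₐ[ℂ] (M.Hpro →L[ℂ] M.Hpro) where
  toFun := M.stageRepFun n
  map_smul' c a := HilbertLimit.clm_ext n fun k hk x => by
    rw [smul_apply, stageRepFun_apply M hk, stageRepFun_apply M hk, map_smul,
      rep_eq, map_smul]
    exact (M.Iinf k).map_smul c _
  map_zero' := HilbertLimit.clm_ext n fun k hk x => by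
    rw [stageRepFun_apply M hk, map_zero, rep_eq, map_zero]
    exact (M.Iinf k).map_zero
  map_add' a b := HilbertLimit.clm_ext n fun k hk x => by
    rw [add_apply, stageRepFun_apply M hk, stageRepFun_apply M hk, stageRepFun_apply M hk, map_add,
      rep_eq, map_add]
    exact (M.Iinf k).map_add _ _
  map_mul' a b := HilbertLimit.clm_ext n fun k hk x => by
    rw [mul_apply_eq_comp, stageRepFun_apply M hk, stageRepFun_apply M hk, stageRepFun_apply M hk,
      map_mul, rep_eq, map_mul]
    rfl
  map_star' a := by
    rw [ContinuousLinearMap.star_eq_adjoint, ContinuousLinearMap.eq_adjoint_iff]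
    intro x y
    refine HilbertLimit.induction_pair n (P := fun x y =>
      ⟪M.stageRepFun n (star a) x, y⟫_ℂ = ⟪x, M.stageRepFun n a y⟫_ℂ)
      (isClosed_eq (by fun_prop) (by fun_prop)) (fun k hk x y => ?_) x y
    rw [stageRepFun_apply M hk, stageRepFun_apply M hk, LinearIsometry.inner_map_map,
      LinearIsometry.inner_map_map, map_star, rep_eq, rep_eq,
      map_star, ContinuousLinearMap.star_eq_adjoint,
      ContinuousLinearMap.adjoint_inner_left]

theorem stageRep_apply {n k : ℕ} (h : n ≤ k) (b : X.B n) (η : M.H k) :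
    M.stageRep n b (M.Iinf k η) = M.Iinf k (M.rep k (X.φTo h b) η) :=
  M.stageRepFun_apply h b η

theorem stageRep_succ (n : ℕ) (b : X.B n) : M.stageRep (n + 1) (X.φ n b) = M.stageRep n b := by
  refine HilbertLimit.clm_ext (n + 1) fun k hk x => ?_
  have hn : n ≤ k := n.le_succ.trans hk
  have h : X.φTo hk (X.φ n b) = X.φTo hn b := by
    rw [← homTo_trans X.φ n.le_succ hk, homTo_succ X.φ le_rfl, homTo_self]
  rw [stageRep_apply M hk, stageRep_apply M hn, h]

/-- On the invariant subspace `I_{n,∞} H_n` the operators act as `π_n`, which is faithful since the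
trace is faithful and `S_n ≠ 0`. -/
theorem stageRep_injective (n : ℕ) : Function.Injective (M.stageRep n) := by
  have := M.nontrivial_S n
  rw [injective_iff_map_eq_zero]
  intro b hb
  refine (injective_iff_map_eq_zero _).1
    (MatTorus.leftMulHom_injective (r := X.r n) (Θ := X.Θ n) (M.S n)) b ?_
  ext1 η
  have h := M.stageRep_apply le_rfl b η
  rw [hb, zero_apply, homTo_self] at h
  exact (M.Iinf n).injective (h.symm.trans (M.Iinf n).map_zero.symm)

theorem exists_limitRep : ∃ π : X.Apro →⋆ₙₐ[ℂ] (M.Hpro →L[ℂ] M.Hpro),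
    Function.Injective π ∧ ∀ n b, π (X.ι n b) = M.stageRep n b := by
  obtain ⟨π, hπ⟩ := CStarLimit.exists_lift (ρ := M.stageRep) M.stageRep_succ
  exact ⟨π, CStarLimit.lift_injective M.stageRep_injective hπ,
    CStarLimit.lift_of M.stageRep_succ hπ⟩

/-! ### The limit Dirac operator and its commutators -/

theorem isSelfAdjoint_Dpro : IsSelfAdjoint M.Dpro :=
  -- `M.Dpro` and the limit operator of `M.D` along `M.I` agree by unfolding.
  isSelfAdjoint_limitOperator M.intertwines_I M.selfAdjoint_D

theorem intertwines_Iinf (n : ℕ) : Intertwines (M.Iinf n) (M.D n) M.Dpro :=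
  intertwines_limitOperator M.intertwines_I M.selfAdjoint_D n

/-- Forward, the stage commutators are the compressions `I_{m,∞}^* T I_{m,∞}`, bounded by `‖T‖`.
Backward, the stage extensions glue to an operator that implements the commutator on the closure. -/
theorem exists_commutator_iff {n : ℕ} (a : X.B n) :
    (∃ T, CommutatorExtendsTo M.Dpro (M.stageRep n a) T) ↔ M.StagewiseBounded a := by
  constructor
  · rintro ⟨T, hT⟩
    refine ⟨‖T‖, fun m h => ⟨_, CommutatorExtendsTo.compression (M.intertwines_Iinf m)
      (M.selfAdjoint_D m) M.isSelfAdjoint_Dpro (M.stageRep_apply h a) hT, ?_⟩⟩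
    refine ContinuousLinearMap.opNorm_le_bound _ (norm_nonneg _) fun x => ?_
    have h1 := ContinuousLinearMap.le_of_opNorm_le _
      (M.Iinf m).norm_toContinuousLinearMap_adjoint_le (T (M.Iinf m x))
    have h2 := T.le_opNorm (M.Iinf m x)
    rw [LinearIsometry.norm_map] at h2
    rw [one_mul] at h1
    exact h1.trans h2
  · rintro ⟨C, hC⟩
    choose T₀ hT₀ hC₀ using hC
    let T : ∀ k, M.H k →L[ℂ] M.H k := fun k => if h : n ≤ k then T₀ k h else 0
    have hT : ∀ k (h : n ≤ k), T k = T₀ k h := fun k h => dif_pos h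
    let a' : ∀ k, M.H k →L[ℂ] M.H k := fun k => if h : n ≤ k then M.rep k (X.φTo h a) else 0
    have ha' : ∀ k (h : n ≤ k), a' k = M.rep k (X.φTo h a) := fun k h => dif_pos h
    -- Compatibility is not part of the hypothesis; it holds because a bounded extension from the
    -- dense domain is unique.
    have hcomp : ∀ k ≥ n, ∀ x, T (k + 1) (M.I k x) = M.I k (T k x) := fun k hk x => by
      rw [hT k hk, hT (k + 1) (Nat.le_succ_of_le hk)]
      refine (hT₀ k hk).intertwine (M.intertwines_I k) (M.selfAdjoint_D k).dense_domain
        (fun y => ?_) (hT₀ (k + 1) _) x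
      rw [I_rep, ← homTo_succ X.φ hk]
    -- The `0` in `max C 0` covers the zero operators below stage `n`.
    obtain ⟨S, hS⟩ := exists_limit_operator (E := M.H) M.I n T (max C 0) (fun k => by
        by_cases h : n ≤ k
        · rw [hT k h]
          exact (hC₀ k h).trans (le_max_left _ _)
        · simp [T, h]) hcomp
    refine ⟨S, commutatorExtendsTo_limitOperator M.intertwines_I M.selfAdjoint_D n (a' := a')
      (fun k hk x => ?_) hS fun k hk => ?_⟩
    · rw [ha' k hk]
      exact M.stageRep_apply hk a x
    · rw [ha' k hk, hT k hk]
      exact hT₀ k hk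

theorem commutator_Iinf {n : ℕ} {a : X.B n} {T : M.Hpro →L[ℂ] M.Hpro}
    (hT : CommutatorExtendsTo M.Dpro (M.stageRep n a) T) {m : ℕ} (h : n ≤ m)
    {Tm : M.H m →L[ℂ] M.H m} (hTm : CommutatorExtendsTo (M.D m) (M.rep m (X.φTo h a)) Tm)
    (η : M.H m) : T (M.Iinf m η) = M.Iinf m (Tm η) :=
  hTm.intertwine (M.intertwines_Iinf m) (M.selfAdjoint_D m).dense_domain (M.stageRep_apply h a)
    hT η

theorem isLimitRep_of_eq {π : X.Apro →⋆ₙₐ[ℂ] (M.Hpro →L[ℂ] M.Hpro)}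
    (hπ : ∀ n b, π (X.ι n b) = M.stageRep n b) : M.IsLimitRep π := by
  intro n m k hn hm b η
  rw [hπ, ← M.stageRep_apply hn, toHilbertLimit_isometryTo]

/-- `π(e_n)` fixes `I_{n,∞} H_n` because `π_n(1) = 1`, so the range vectors already contain the
dense union of the stages. -/
theorem isNondegenerateRep_of_eq {π : X.Apro →⋆ₙₐ[ℂ] (M.Hpro →L[ℂ] M.Hpro)}
    (hπ : ∀ n b, π (X.ι n b) = M.stageRep n b) : IsNondegenerateRep π := by
  refine (dense_toHilbertLimit (E := M.H) M.I 0).mono ?_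
  rintro _ ⟨n, -, η, rfl⟩
  refine Submodule.subset_span ⟨X.ι n 1, M.Iinf n η, ?_⟩
  rw [hπ, M.stageRep_apply le_rfl, homTo_self]
  congr 1
  refine (congrArg (fun T : M.H n →L[ℂ] M.H n => T η) (L2Tensor.clm_ext (X.τ n)
    (T := M.rep n 1) (T' := 1) fun x => ?_)).symm
  rw [L2Tensor.leftMul_ofTensor]
  have h1 : (X.τ n).gnsNonUnitalStarAlgHom 1 = 1 := map_one (X.τ n).gnsStarAlgHom
  rw [h1]
  exact congrArg (L2Tensor.ofTensor (X.τ n)) (LinearMap.rTensor_id_apply _ _ x)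

end MoritaDirac

/-- With `a = e_n a e_n` one has `π(a) R = π(e_n a) (π(e_n) R)`, and compact operators absorb
bounded factors on the left. -/
theorem isLocallyCompactOn_iff {X : ProtoralSystem} {H : Type*} [NormedAddCommGroup H]
    [InnerProductSpace ℂ H] [CompleteSpace H] {𝒜 : NonUnitalStarSubalgebra ℂ X.Apro}
    (h𝒜 : X.IsFinitelySupported 𝒜) (π : X.Apro →⋆ₙₐ[ℂ] (H →L[ℂ] H)) (D : H →ₗ.[ℂ] H) :
    IsLocallyCompactOn 𝒜 π D ↔ ∀ n, IsCompactOperator (π (X.e n) ∘L invSqrtOneAddSq D) := by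
  refine ⟨fun h n => h _ (h𝒜.e_mem n), fun h a ha => ?_⟩
  obtain ⟨n, hn⟩ := h𝒜.supported a ha
  rw [hn, map_mul]
  exact (h n).clm_comp (π (X.e n * a))

end Protorus

end

open Protorus in
/-- Spectral triples on protori from Morita-compatible Dirac structures. The limit representation
`π` of `A_pro` on `H_pro` exists, is faithful and nondegenerate, and `D_pro` is selfadjoint.
(i) For smooth `a ∈ B_n`, the commutator `[D_pro, π(ι_n(a))]` extends boundedly iff the stagewise
commutators extend boundedly with uniformly bounded norms, and then the extension `T` satisfies
`T I_{m,∞} = I_{m,∞} T_m`. (ii) Local compactness on a dense finitely supported `*`-subalgebra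
containing the `e_n` is equivalent to compactness of all `π(e_n)(1 + D_pro²)^{-1/2}`.
(iii) Together these conditions give a locally compact spectral triple. -/
theorem mainTheorem12 (X : ProtoralSystem) (M : MoritaDirac X) :
    ∃ π : X.Apro →⋆ₙₐ[ℂ] (M.Hpro →L[ℂ] M.Hpro),
      M.IsLimitRep π ∧ Function.Injective π ∧ IsNondegenerateRep π ∧ IsSelfAdjoint M.Dpro ∧
      (∀ (n : ℕ) (a : X.B n), a.IsSmooth →
        ((∃ T, CommutatorExtendsTo M.Dpro (π (X.ι n a)) T) ↔ M.StagewiseBounded a) ∧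
        ∀ T, CommutatorExtendsTo M.Dpro (π (X.ι n a)) T →
          ∀ (m : ℕ) (h : n ≤ m) (Tm : M.H m →L[ℂ] M.H m),
            CommutatorExtendsTo (M.D m) (M.rep m (X.φTo h a)) Tm →
              ∀ η : M.H m, T (M.Iinf m η) = M.Iinf m (Tm η)) ∧
      (∀ 𝒜 : NonUnitalStarSubalgebra ℂ X.Apro, X.IsFinitelySupported 𝒜 →
        (IsLocallyCompactOn 𝒜 π M.Dpro ↔
          ∀ n, IsCompactOperator (π (X.e n) ∘L invSqrtOneAddSq M.Dpro))) ∧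
      (∀ 𝒜 : NonUnitalStarSubalgebra ℂ X.Apro, X.IsFinitelySupported 𝒜 →
        (∀ a ∈ 𝒜, (∃ T, CommutatorExtendsTo M.Dpro (π a) T) ∨
          ∃ (n : ℕ) (b : X.B n), b.IsSmooth ∧ a = X.ι n b ∧ M.StagewiseBounded b) →
        (∀ n, IsCompactOperator (π (X.e n) ∘L invSqrtOneAddSq M.Dpro)) →
        IsLocallyCompactSpectralTriple 𝒜 π M.Dpro) := by
  obtain ⟨π, hinj, hπ⟩ := M.exists_limitRep
  have hcomm : ∀ (n : ℕ) (a : X.B n),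
      (∃ T, CommutatorExtendsTo M.Dpro (π (X.ι n a)) T) ↔ M.StagewiseBounded a := by
    intro n a
    rw [hπ]
    exact M.exists_commutator_iff a
  refine ⟨π, M.isLimitRep_of_eq hπ, hinj, M.isNondegenerateRep_of_eq hπ, M.isSelfAdjoint_Dpro,
    fun n a _ => ⟨hcomm n a, fun T hT m h Tm hTm η => ?_⟩,
    fun 𝒜 h𝒜 => isLocallyCompactOn_iff h𝒜 π M.Dpro, fun 𝒜 h𝒜 hb hc => ?_⟩
  · rw [hπ] at hT
    exact M.commutator_Iinf hT h hTm η
  · refine ⟨hinj, M.isNondegenerateRep_of_eq hπ, M.isSelfAdjoint_Dpro, h𝒜.dense, fun a ha => ?_,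
      (isLocallyCompactOn_iff h𝒜 π M.Dpro).2 hc⟩
    -- By (i) the stagewise alternative reduces to the first one.
    rcases hb a ha with h | ⟨n, b, -, rfl, h⟩
    · exact h
    · exact (hcomm n b).2 h
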